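/- Let $p=3k+1$ be a prime number, and write $\mu_n$ for the cyclic group of order $n$. Let $\varphi:\mu_3\to\operatorname{Aut}(\mu_p)\cong\mu_{3k}$ be a non-trivial homomorphism (it exists, and the group below does not depend on the choice up to isomorphism), and let $G_p=\mu_p\rtimes_\varphi\mu_3$ be the corresponding semidirect product. Then there exist a number field $K$ and a non-trivial Severi--Brauer surface $S$ over $K$, that is, a $K$-scheme $S$ such that $S\times_K\overline K\cong\mathbb{P}^2_{\overline K}$ over the algebraic closure $\overline K$ of $K$, but $S\not\cong\mathbb{P}^2_K$ over $K$, such that the group $\operatorname{Aut}(S)$ of automorphisms of $S$ over $K$ contains a subgroup isomorphic to $G_p$. Moreover, the smallest index of a normal abelian subgroup of $G_p$ is $3$. Hence the constant $3$ in the following known result cannot be lowered: every finite group acting by birational automorphisms of a non-trivial Severi--Brauer surface over a field of characteristic zero is either abelian or contains a normal abelian subgroup of index $3$. -/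

import Mathlib

open CategoryTheory AlgebraicGeometry

noncomputable section

section

attribute [local instance] MvPolynomial.gradedAlgebra

/-- The projective plane over a field `K`, as a scheme over `Spec K`: it is
`Proj K[x₀, x₁, x₂]` for the grading by degree, and the structure morphism is the canonical
morphism to the spectrum of the degree-zero part `K[x₀, x₁, x₂]₀`, followed by the morphism to
`Spec K` given by the inclusion of the constants. -/
def projectivePlane (K : Type) [Field K] : Over (Spec (CommRingCat.of K)) :=
  Over.mk
    (Proj.toSpecZero (MvPolynomial.homogeneousSubmodule (Fin 3) K) ≫
      Spec.map (CommRingCat.ofHom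
        (algebraMap K (MvPolynomial.homogeneousSubmodule (Fin 3) K 0))))

end

/-- A Severi–Brauer surface over a field `K` is a `K`-scheme that becomes isomorphic to the
projective plane after base change to the algebraic closure of `K`; the isomorphism is one of
schemes over the algebraic closure. By faithfully flat descent such a scheme is automatically
a smooth, proper and geometrically integral surface over `K`. -/
def IsSeveriBrauerSurface (K : Type) [Field K] (S : Over (Spec (CommRingCat.of K))) : Prop :=
  Nonempty
    ((Over.pullback
        (Spec.map (CommRingCat.ofHom (algebraMap K (AlgebraicClosure K))))).obj S ≅
      projectivePlane (AlgebraicClosure K))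

/-- A Severi–Brauer surface over `K` is non-trivial if it is not isomorphic, as a `K`-scheme, to
the projective plane over `K`. -/
def IsNontrivialSeveriBrauerSurface (K : Type) [Field K]
    (S : Over (Spec (CommRingCat.of K))) : Prop :=
  IsSeveriBrauerSurface K S ∧ IsEmpty (S ≅ projectivePlane K)

/-- The semidirect product of a cyclic group of order `p` and a cyclic group of order `3` (both
written multiplicatively), for an action `φ` of the second on the first. -/
abbrev CyclicSemidirect (p : ℕ)
    (φ : Multiplicative (ZMod 3) →* MulAut (Multiplicative (ZMod p))) : Type :=
  Multiplicative (ZMod p) ⋊[φ] Multiplicative (ZMod 3)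

end

/-! Let L be the p-th cyclotomic field. Through Aut(μ_p) ≅ (ℤ/p)ˣ ≅ Gal(L/ℚ), the homomorphism φ
makes μ_3 act faithfully on L; let K be the fixed field and σ a generator of Gal(L/K). By Dirichlet
there is a prime q that is a primitive root mod p. It is inert in L
(`IsCyclotomicExtension.Rat.prime_natCast`), so a norm from L to K has q-adic valuation divisible by
3, and q itself is not a norm (`NumberField.mul_mul_ne_natCast`).

The surface is the twisted plane of the cyclic algebra given by (L/K, σ, q). The σ-semilinear
substitution X₀ ↦ X₁ ↦ X₂ ↦ q X₀ has cube q^n on forms of degree n, so for 3 ∣ n it can be rescaled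
to order three and defines a descent datum; S is `Proj` of the descended forms. Descent along L/K
shows that S becomes the plane over every extension of L (`isPullback_toPolynomial`). A K-point of S
yields x with norm q (`exists_norm_eq_of_algHom`), so S has no K-point and is not the plane.

On the forms, μ_p acts by diag(ζ, σζ, σ²ζ) and μ_3 by Galois on coefficients. Both commute with the
twist, and the Galois action on ζ is φ, so the semidirect product acts on S. On descended forms the
action of σ on coefficients is, up to a scalar, the inverse of the cyclic substitution of variables,
hence it is a geometric automorphism. The action is faithful because it is so on μ_p
(`char_pow_three_eq_one`) and φ is injective.

The index statement is pure group theory: the index divides 3p, which is odd, and the group is not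
abelian. -/

noncomputable section

/-! ### Morphisms between `Proj` schemes, glued from charts. -/

section Proj

open Limits HomogeneousLocalization Graded

section ProjCover

variable {A σ : Type} [CommRing A] [SetLike σ A] [AddSubgroupClass σ A]
  (𝒜 : ℕ → σ) [GradedRing 𝒜]

/-- The cover of `Proj 𝒜` by the `D₊(f i)`, for a family of homogeneous elements of positive
degree without common zero. -/
def projCover {ι : Type} (f : ι → A) (m : ι → ℕ) (hf : ∀ i, f i ∈ 𝒜 (m i)) (hm : ∀ i, 0 < m i)
    (hcov : ∀ x : Proj 𝒜, ∃ i, x ∈ Proj.basicOpen 𝒜 (f i)) : (Proj 𝒜).AffineOpenCover where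
  I₀ := ι
  X i := .of (Away 𝒜 (f i))
  f i := Proj.awayι 𝒜 (f i) (hf i) (hm i)
  idx x := (hcov x).choose
  covers x := by
    change x ∈ (Proj.awayι 𝒜 _ _ _).opensRange
    rw [Proj.opensRange_awayι]
    exact (hcov x).choose_spec

end ProjCover

section ProjGlue

variable {A B σ τ : Type} [CommRing A] [SetLike σ A] [AddSubgroupClass σ A]
  [CommRing B] [SetLike τ B] [AddSubgroupClass τ B]
  {𝒜 : ℕ → σ} {ℬ : ℕ → τ} [GradedRing 𝒜] [GradedRing ℬ] (g : 𝒜 →+*ᵍ ℬ)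

lemma awayMap_comp_map {d e : ℕ} {s t : A} (hs : s ∈ 𝒜 d) (ht : t ∈ 𝒜 e) {x : A}
    (hx : x = s * t) :
    (awayMap ℬ (map_mem g ht) (by rw [hx, map_mul]) :
      Away ℬ (g s) →+* Away ℬ (g x)).comp (Away.map g s) =
      (Away.map g x).comp (awayMap 𝒜 ht hx) := by
  ext1 z
  obtain ⟨n, a, ha, rfl⟩ := Away.mk_surjective 𝒜 hs z
  simp only [RingHom.comp_apply, Away.map_mk, awayMap_mk]
  subst hx
  apply HomogeneousLocalization.val_injective
  rw [Away.val_mk, Away.val_mk]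
  simp

/-- The morphism `D₊(g s) ⟶ Proj 𝒜` induced by a graded ring homomorphism. -/
def awayToProj {d : ℕ} (s : A) (hs : s ∈ 𝒜 d) (hd : 0 < d) :
    Spec (.of (Away ℬ (g s))) ⟶ Proj 𝒜 :=
  Spec.map (CommRingCat.ofHom (Away.map g s)) ≫ Proj.awayι 𝒜 s hs hd

/-- The restriction to D₊(g x), for x = s t, depends only on x and not on the factor s. With the
roles of s and t exchanged, this is the gluing condition on overlaps. -/
lemma awayMap_awayToProj {d e : ℕ} (hd : 0 < d) {s t : A} (hs : s ∈ 𝒜 d) (ht : t ∈ 𝒜 e)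
    {x : A} (hx : x = s * t) {n : ℕ} (hx' : x ∈ 𝒜 n) (hn : 0 < n) :
    Spec.map (CommRingCat.ofHom (awayMap ℬ (map_mem g ht) (by rw [hx, map_mul]) :
      Away ℬ (g s) →+* Away ℬ (g x))) ≫ awayToProj g s hs hd = awayToProj g x hx' hn := by
  rw [awayToProj, ← Category.assoc, ← Spec.map_comp, ← CommRingCat.ofHom_comp,
    awayMap_comp_map g hs ht hx, CommRingCat.ofHom_comp, Spec.map_comp, Category.assoc,
    Proj.SpecMap_awayMap_awayι]
  rfl

variable {ι : Type} (f : ι → A) (m : ι → ℕ) (hf : ∀ i, f i ∈ 𝒜 (m i)) (hm : ∀ i, 0 < m i)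
  (hcov : ∀ x : Proj ℬ, ∃ i, x ∈ Proj.basicOpen ℬ (g (f i)))

/-- The morphism `Proj ℬ ⟶ Proj 𝒜` induced by a graded ring homomorphism `g` when the `D₊(g s)`
cover `Proj ℬ`. -/
def projGlue : Proj ℬ ⟶ Proj 𝒜 :=
  -- Covering by the D₊(g (f i)) is weaker than asking that the image of the irrelevant ideal
  -- generate that of ℬ. The latter fails for the twisted plane, whose ring lives in degrees
  -- divisible by three: no Xᵢ is in the ideal generated by its forms of positive degree.
  (projCover ℬ (fun i ↦ g (f i)) m (fun i ↦ map_mem g (hf i)) hm hcov).openCover.glueMorphisms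
    (fun i ↦ awayToProj g (f i) (hf i) (hm i)) <| by
    intro i j
    change pullback.fst (Proj.awayι ℬ (g (f i)) (map_mem g (hf i)) (hm i))
        (Proj.awayι ℬ (g (f j)) (map_mem g (hf j)) (hm j)) ≫ _ = pullback.snd _ _ ≫ _
    rw [← cancel_epi (Proj.pullbackAwayιIso ℬ (map_mem g (hf i)) (hm i) (map_mem g (hf j)) (hm j)
      (map_mul g (f i) (f j))).inv]
    rw [Proj.pullbackAwayιIso_inv_fst_assoc, Proj.pullbackAwayιIso_inv_snd_assoc]
    rw [awayMap_awayToProj g (hm i) (hf i) (hf j) rfl (SetLike.mul_mem_graded (hf i) (hf j))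
      (Nat.add_pos_left (hm i) _)]
    rw [awayMap_awayToProj g (hm j) (hf j) (hf i) (mul_comm _ _)
      (SetLike.mul_mem_graded (hf i) (hf j)) (Nat.add_pos_left (hm i) _)]

lemma awayι_projGlue (i : ι) :
    Proj.awayι ℬ (g (f i)) (map_mem g (hf i)) (hm i) ≫ projGlue g f m hf hm hcov =
      Spec.map (CommRingCat.ofHom (Away.map g (f i))) ≫ Proj.awayι 𝒜 (f i) (hf i) (hm i) :=
  (projCover ℬ (fun i ↦ g (f i)) m (fun i ↦ map_mem g (hf i)) hm hcov).openCover.ι_glueMorphisms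
    _ _ i

lemma projGlue_preimage_basicOpen (i : ι) :
    projGlue g f m hf hm hcov ⁻¹ᵁ Proj.basicOpen 𝒜 (f i) = Proj.basicOpen ℬ (g (f i)) := by
  ext x
  obtain ⟨j, hj⟩ := hcov x
  rw [← Proj.opensRange_awayι ℬ (g (f j)) (map_mem g (hf j)) (hm j)] at hj
  obtain ⟨y, rfl⟩ := hj
  have h1 : Proj.awayι ℬ (g (f j)) (map_mem g (hf j)) (hm j) ⁻¹ᵁ
        (projGlue g f m hf hm hcov ⁻¹ᵁ Proj.basicOpen 𝒜 (f i)) =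
      Proj.awayι ℬ (g (f j)) (map_mem g (hf j)) (hm j) ⁻¹ᵁ Proj.basicOpen ℬ (g (f i)) := by
    rw [← Scheme.Hom.comp_preimage, awayι_projGlue, Scheme.Hom.comp_preimage,
      Proj.awayι_preimage_basicOpen 𝒜 (hf j) (hm j) (hf i) (hm i),
      Proj.awayι_preimage_basicOpen ℬ (map_mem g (hf j)) (hm j) (map_mem g (hf i)) (hm i)]
    ext z
    change Away.map g (f j) (Away.isLocalizationElem (hf j) (hf i)) ∉ z.asIdeal ↔
      Away.isLocalizationElem (map_mem g (hf j)) (map_mem g (hf i)) ∉ z.asIdeal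
    have : Away.map g (f j) (Away.isLocalizationElem (hf j) (hf i)) =
        Away.isLocalizationElem (map_mem g (hf j)) (map_mem g (hf i)) := by
      rw [Away.isLocalizationElem, Away.map_mk]
      apply HomogeneousLocalization.val_injective
      simp [Away.val_mk]
    rw [this]
  exact congr(y ∈ $h1).to_iff

lemma isPullback_projGlue_away (i : ι) :
    IsPullback (Spec.map (CommRingCat.ofHom (Away.map g (f i))))
      (Proj.awayι ℬ (g (f i)) (map_mem g (hf i)) (hm i)) (Proj.awayι 𝒜 (f i) (hf i) (hm i))
      (projGlue g f m hf hm hcov) := by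
  apply IsOpenImmersion.isPullback
  · exact awayι_projGlue ..
  · rw [Proj.opensRange_awayι, Proj.opensRange_awayι, projGlue_preimage_basicOpen]

/-- Being an isomorphism is local on the target. Over the preimage of D₊(f i) in the fibre product,
the comparison map `c` is an isomorphism because D₊(g (f i)) is both the preimage of D₊(f i) and, by
`h`, its base change. -/
lemma isPullback_projGlue {T U : Scheme} (p : Proj 𝒜 ⟶ T) (q : Proj ℬ ⟶ U) (b : U ⟶ T)
    (hcov' : ∀ x : Proj 𝒜, ∃ i, x ∈ Proj.basicOpen 𝒜 (f i))
    (h : ∀ i, IsPullback (Spec.map (CommRingCat.ofHom (Away.map g (f i))))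
      (Proj.awayι ℬ (g (f i)) (map_mem g (hf i)) (hm i) ≫ q)
      (Proj.awayι 𝒜 (f i) (hf i) (hm i) ≫ p) b) :
    IsPullback (projGlue g f m hf hm hcov) q p b := by
  have hw : projGlue g f m hf hm hcov ≫ p = q ≫ b := by
    refine (projCover ℬ (fun i ↦ g (f i)) m
      (fun i ↦ map_mem g (hf i)) hm hcov).openCover.hom_ext _ _ fun (i : ι) ↦ ?_
    change Proj.awayι ℬ (g (f i)) (map_mem g (hf i)) (hm i) ≫ _ =
      Proj.awayι ℬ (g (f i)) (map_mem g (hf i)) (hm i) ≫ _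
    rw [← Category.assoc, awayι_projGlue, Category.assoc, (h i).w, Category.assoc]
  obtain ⟨c, hc₁, hc₂⟩ : ∃ c : Proj ℬ ⟶ pullback p b,
      c ≫ pullback.fst p b = projGlue g f m hf hm hcov ∧ c ≫ pullback.snd p b = q :=
    ⟨pullback.lift _ _ hw, pullback.lift_fst _ _ _, pullback.lift_snd _ _ _⟩
  have hc : IsIso c := by
    change MorphismProperty.isomorphisms Scheme c
    refine (IsZariskiLocalAtTarget.iff_of_openCover (P := .isomorphisms Scheme)
      ((projCover 𝒜 f m hf hm hcov').openCover.pullback₁ (pullback.fst p b))).mpr ?_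
    change ∀ i : ι, IsIso (pullback.snd c
      (pullback.fst (pullback.fst p b) (Proj.awayι 𝒜 (f i) (hf i) (hm i))))
    intro i
    have h1 : IsPullback (Spec.map (CommRingCat.ofHom (Away.map g (f i))))
        (Proj.awayι ℬ (g (f i)) (map_mem g (hf i)) (hm i) ≫ c)
        (Proj.awayι 𝒜 (f i) (hf i) (hm i)) (pullback.fst p b) := by
      refine IsPullback.of_bot (v₂₁ := pullback.snd p b) (v₂₂ := p) (h₃₁ := b) ?_ ?_
        (IsPullback.of_hasPullback p b)
      · simpa [hc₂] using h i
      · simp [hc₁, awayι_projGlue]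
    have h2 : IsPullback (𝟙 _) (Proj.awayι ℬ (g (f i)) (map_mem g (hf i)) (hm i))
        (Proj.awayι ℬ (g (f i)) (map_mem g (hf i)) (hm i) ≫ c) c := by
      refine IsPullback.of_right (h₁₂ := Spec.map (CommRingCat.ofHom (Away.map g (f i))))
        (v₁₃ := Proj.awayι 𝒜 (f i) (hf i) (hm i)) (h₂₂ := pullback.fst p b) ?_ (by simp) h1
      simpa [hc₁] using isPullback_projGlue_away g f m hf hm hcov i
    have h3 : IsPullback (Proj.awayι ℬ (g (f i)) (map_mem g (hf i)) (hm i))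
        h1.flip.isoPullback.hom c
        (pullback.fst (pullback.fst p b) (Proj.awayι 𝒜 (f i) (hf i) (hm i))) := by
      refine h2.flip.of_iso (Iso.refl _) (Iso.refl _) h1.flip.isoPullback (Iso.refl _)
        (by simp) (by simp) (by simp) ?_
      rw [h1.flip.isoPullback_hom_fst]
      simp
    rw [← h3.isoPullback_inv_snd]
    infer_instance
  exact IsPullback.of_iso_pullback ⟨hw⟩ (asIso c) (by simpa using hc₁) (by simpa using hc₂)

end ProjGlue

/-! ### Structure morphisms to the base field, and base change of `Proj` along a field extension. -/

section HomogeneousLocalizationAlgebra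

variable {K A : Type} [CommRing K] [CommRing A] [Algebra K A] (𝒜 : ℕ → Submodule K A)
  [GradedAlgebra 𝒜]

instance homogeneousLocalizationScalarAlgebra (P : Submonoid A) :
    Algebra K (HomogeneousLocalization 𝒜 P) where
  algebraMap := (fromZeroRingHom 𝒜 P).comp (algebraMap K (𝒜 0))
  commutes' _ _ := mul_comm _ _
  smul_def' c x := by
    apply HomogeneousLocalization.val_injective
    obtain ⟨x, rfl⟩ := HomogeneousLocalization.mk_surjective x
    rw [val_smul, val_mul, val_mk]
    change _ = Localization.mk (algebraMap K A c) 1 * _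
    rw [Localization.mk_mul, Localization.smul_mk, Algebra.smul_def, one_mul]

lemma val_algebraMap_scalar (P : Submonoid A) (c : K) :
    (algebraMap K (HomogeneousLocalization 𝒜 P) c).val =
      algebraMap A (Localization P) (algebraMap K A c) := rfl

/-- The structure morphism of `Proj` of a graded `K`-algebra. -/
def projToSpec : Proj 𝒜 ⟶ Spec (.of K) :=
  Proj.toSpecZero 𝒜 ≫ Spec.map (CommRingCat.ofHom (algebraMap K (𝒜 0)))

lemma awayι_projToSpec {m : ℕ} (f : A) (hf : f ∈ 𝒜 m) (hm : 0 < m) :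
    Proj.awayι 𝒜 f hf hm ≫ projToSpec 𝒜 =
      Spec.map (CommRingCat.ofHom (algebraMap K (Away 𝒜 f))) := by
  rw [projToSpec, Proj.awayι_toSpecZero_assoc, ← Spec.map_comp]
  rfl

end HomogeneousLocalizationAlgebra

lemma isBaseChange_of_basis {K M V W ι : Type} [CommRing K] [CommRing M] [Algebra K M]
    [AddCommGroup V] [Module K V] [AddCommGroup W] [Module K W] [Module M W]
    [IsScalarTower K M W] (f : V →ₗ[K] W) (b : Module.Basis ι K V)
    (hli : LinearIndependent M (f ∘ b)) (hsp : ⊤ ≤ Submodule.span M (Set.range (f ∘ b))) :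
    IsBaseChange M f := by
  refine IsBaseChange.of_equiv
    ((b.baseChange M).equiv (Module.Basis.mk hli hsp) (Equiv.refl _)) fun x ↦ ?_
  induction b.mem_span x using Submodule.span_induction with
  | zero => simp
  | add x y _ _ hx hy => simp only [TensorProduct.tmul_add, map_add, hx, hy]
  | smul c x _ hx =>
    rw [TensorProduct.tmul_smul, ← algebraMap_smul M c, map_smul, hx, map_smul, algebraMap_smul]
  | mem x hx =>
    obtain ⟨i, rfl⟩ := hx
    rw [← Module.Basis.baseChange_apply, Module.Basis.equiv_apply]
    simp

/-- The two conditions say that a K-basis of P maps to an M-basis of Q. Independence is needed only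
for finite families, which is the form in which denominators can be cleared. -/
lemma isPushout_of_linearIndependent {K M P Q : Type} [Field K] [CommRing M] [Algebra K M]
    [CommRing P] [CommRing Q] [Algebra K P] [Algebra M Q] (h : P →+* Q)
    (hK : ∀ c : K, h (algebraMap K P c) = algebraMap M Q (algebraMap K M c))
    (hind : ∀ {r : ℕ} (v : Fin r → P), LinearIndependent K v → LinearIndependent M (h ∘ v))
    (hspan : ⊤ ≤ Submodule.span M (Set.range h)) :
    IsPushout (CommRingCat.ofHom (algebraMap K M)) (CommRingCat.ofHom (algebraMap K P))
      (CommRingCat.ofHom (algebraMap M Q)) (CommRingCat.ofHom h) := by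
  let _ : Algebra P Q := h.toAlgebra
  let _ : Algebra K Q := ((algebraMap M Q).comp (algebraMap K M)).toAlgebra
  have _ : IsScalarTower K M Q := .of_algebraMap_eq fun _ ↦ rfl
  have _ : IsScalarTower K P Q := .of_algebraMap_eq fun c ↦ (hK c).symm
  let b := Module.Basis.ofVectorSpace K P
  have _ : Algebra.IsPushout K M P Q := by
    constructor
    refine isBaseChange_of_basis _ b ?_ ?_
    · rw [linearIndependent_iff_finset_linearIndependent]
      intro s
      rw [← linearIndependent_equiv s.equivFin.symm]
      exact hind _ (b.linearIndependent.comp (fun i : Fin s.card ↦ s.equivFin.symm i)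
        (Subtype.val_injective.comp s.equivFin.symm.injective))
    · refine hspan.trans (Submodule.span_le.mpr ?_)
      rintro _ ⟨x, rfl⟩
      induction b.mem_span x using Submodule.span_induction with
      | zero => rw [map_zero]; exact zero_mem _
      | add x y _ _ hx hy => rw [map_add]; exact add_mem hx hy
      | smul c x _ hx =>
        rw [Algebra.smul_def, map_mul, hK, ← Algebra.smul_def]
        exact Submodule.smul_mem _ _ hx
      | mem x hx =>
        obtain ⟨i, rfl⟩ := hx
        exact Submodule.subset_span ⟨i, rfl⟩
  exact CommRingCat.isPushout_of_isPushout K M P Q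

section Pushout

variable {K M A B : Type} [Field K] [Field M] [Algebra K M] [CommRing A] [CommRing B]
  [Algebra K A] [Algebra M B] {𝒜 : ℕ → Submodule K A} {ℬ : ℕ → Submodule M B}
  [GradedAlgebra 𝒜] [GradedAlgebra ℬ] (g : 𝒜 →+*ᵍ ℬ)

/-- Holding for all large n, rather than for some n, lets finitely many fractions share one
denominator. -/
lemma eventually_exists_away_mk {m : ℕ} {f : A} (hf : f ∈ 𝒜 m) (z : Away 𝒜 f) :
    ∀ᶠ n in Filter.atTop, ∃ x, ∃ hx : x ∈ 𝒜 (n • m), z = Away.mk 𝒜 hf n x hx := by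
  filter_upwards [Away.eventually_smul_mem hf z] with n hn
  obtain ⟨x, hx, hxz⟩ := hn
  refine ⟨x, hx, HomogeneousLocalization.val_injective _ ?_⟩
  rw [Away.val_mk, Localization.mk_eq_mk'_apply]
  rw [eq_comm, IsLocalization.mk'_eq_iff_eq_mul, hxz, Algebra.smul_def, mul_comm]

/-- Fractions with a fixed denominator, as a linear map. -/
def awayMkLinear {m : ℕ} {f : A} (hf : f ∈ 𝒜 m) (n : ℕ) : 𝒜 (n • m) →ₗ[K] Away 𝒜 f where
  toFun x := Away.mk 𝒜 hf n x x.2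
  map_add' x y := by
    apply HomogeneousLocalization.val_injective
    simp [Away.val_mk, Localization.add_mk_self]
  map_smul' c x := by
    apply HomogeneousLocalization.val_injective
    simp [Away.val_mk, Localization.smul_mk]

lemma awayMkLinear_eq_zero_iff {m : ℕ} {f : A} (hf : f ∈ 𝒜 m) (n : ℕ) (x : 𝒜 (n • m)) :
    awayMkLinear hf n x = 0 ↔ ∃ k, f ^ k * (x : A) = 0 := by
  rw [← (HomogeneousLocalization.val_injective _).eq_iff, HomogeneousLocalization.val_zero]
  change Localization.mk _ _ = 0 ↔ _
  rw [Localization.mk_eq_mk'_apply, IsLocalization.mk'_eq_zero_iff]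
  simp [Submonoid.mem_powers_iff]

-- With a common denominator, a relation between the fractions becomes, after multiplication by a
-- power of f, a relation between elements of a single graded piece, where `hind` applies.
omit [Algebra K M] in
lemma linearIndependent_awayMap {m : ℕ} {f : A} (hf : f ∈ 𝒜 m)
    (hind : ∀ (n r : ℕ) (v : Fin r → A), (∀ i, v i ∈ 𝒜 n) → LinearIndependent K v →
      LinearIndependent M (g ∘ v))
    {r : ℕ} (v : Fin r → Away 𝒜 f) (hv : LinearIndependent K v) :
    LinearIndependent M (Away.map g f ∘ v) := by
  have h1 : ∀ᶠ n in Filter.atTop, ∀ i, ∃ x, ∃ hx : x ∈ 𝒜 (n • m), v i = Away.mk 𝒜 hf n x hx :=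
    Filter.eventually_all.mpr fun i ↦ eventually_exists_away_mk hf (v i)
  obtain ⟨n, hn⟩ := h1.exists
  choose x hx hvx using hn
  rw [Fintype.linearIndependent_iff]
  intro c hc
  have h2 : awayMkLinear (map_mem g hf) n (∑ i, c i • ⟨g (x i), map_mem g (hx i)⟩) = 0 := by
    rw [map_sum, ← hc]
    refine Finset.sum_congr rfl fun i _ ↦ ?_
    rw [map_smul, Function.comp_apply, hvx, Away.map_mk]
    rfl
  obtain ⟨k, hk⟩ := (awayMkLinear_eq_zero_iff _ _ _).mp h2
  have h3 : LinearIndependent K fun i ↦ f ^ k * x i := by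
    rw [Fintype.linearIndependent_iff] at hv ⊢
    intro d hd
    apply hv
    have : awayMkLinear hf n (∑ i, d i • ⟨x i, hx i⟩) = 0 := by
      rw [awayMkLinear_eq_zero_iff]
      refine ⟨k, ?_⟩
      rw [← hd]
      simp [Finset.mul_sum]
    rw [← this, map_sum]
    refine Finset.sum_congr rfl fun i _ ↦ ?_
    rw [map_smul, hvx]
    rfl
  have h4 := hind _ r _ (fun i ↦ SetLike.mul_mem_graded (SetLike.pow_mem_graded k hf) (hx i)) h3
  rw [Fintype.linearIndependent_iff] at h4
  apply h4
  rw [← hk]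
  simp [Finset.mul_sum]

omit [Algebra K M] in
lemma span_awayMap {m : ℕ} {f : A} (hf : f ∈ 𝒜 m)
    (hspan : ∀ k : ℕ, ∀ y ∈ ℬ (k • m), y ∈ Submodule.span M (g '' (𝒜 (k • m) : Set A))) :
    ⊤ ≤ Submodule.span M (Set.range (Away.map g f)) := by
  rintro z -
  obtain ⟨n, y, hy, rfl⟩ := Away.mk_surjective ℬ (map_mem g hf) z
  have h1 : (⟨y, hy⟩ : ℬ (n • m)) ∈ (Submodule.span M (Set.range fun x : 𝒜 (n • m) ↦
      (⟨g x, map_mem g x.2⟩ : ℬ (n • m)))) := by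
    have h := hspan n y hy
    rw [show g '' (𝒜 (n • m) : Set A) = (ℬ (n • m)).subtype '' (Set.range fun x : 𝒜 (n • m) ↦
      (⟨g x, map_mem g x.2⟩ : ℬ (n • m))) by
        rw [← Set.range_comp, Set.image_eq_range]; rfl, ← Submodule.map_span] at h
    obtain ⟨w, hw, hwy⟩ := h
    rwa [← show w = ⟨y, hy⟩ from Subtype.ext hwy]
  have h2 := Submodule.mem_map_of_mem (f := awayMkLinear (𝒜 := ℬ) (map_mem g hf) n) h1
  rw [Submodule.map_span] at h2
  refine Submodule.span_mono ?_ h2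
  rintro _ ⟨_, ⟨x, rfl⟩, rfl⟩
  exact ⟨Away.mk 𝒜 hf n x x.2, Away.map_mk ..⟩

omit [GradedAlgebra ℬ] [Algebra K M] [Algebra M B] in
lemma algebraMap_eq_awayMk {m : ℕ} {f : A} (hf : f ∈ 𝒜 m) (c : K) :
    algebraMap K (Away 𝒜 f) c = Away.mk 𝒜 hf 0 (algebraMap K A c)
      (by simpa using SetLike.algebraMap_mem_graded 𝒜 c) := by
  apply HomogeneousLocalization.val_injective
  rw [val_algebraMap_scalar, Away.val_mk, ← Localization.mk_one_eq_algebraMap]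
  congr 1
  exact Subtype.ext (pow_zero f).symm

lemma algebraMap_awayMap {m : ℕ} {f : A} (hf : f ∈ 𝒜 m)
    (hg : ∀ c : K, g (algebraMap K A c) = algebraMap M B (algebraMap K M c)) (c : K) :
    Away.map g f (algebraMap K (Away 𝒜 f) c) =
      algebraMap M (Away ℬ (g f)) (algebraMap K M c) := by
  rw [algebraMap_eq_awayMk hf, algebraMap_eq_awayMk (map_mem g hf), Away.map_mk]
  simp only [hg]

lemma isPushout_awayMap {m : ℕ} {f : A} (hf : f ∈ 𝒜 m)
    (hg : ∀ c : K, g (algebraMap K A c) = algebraMap M B (algebraMap K M c))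
    (hind : ∀ (n r : ℕ) (v : Fin r → A), (∀ i, v i ∈ 𝒜 n) → LinearIndependent K v →
      LinearIndependent M (g ∘ v))
    (hspan : ∀ k : ℕ, ∀ y ∈ ℬ (k • m), y ∈ Submodule.span M (g '' (𝒜 (k • m) : Set A))) :
    IsPushout (CommRingCat.ofHom (algebraMap K M))
      (CommRingCat.ofHom (algebraMap K (Away 𝒜 f)))
      (CommRingCat.ofHom (algebraMap M (Away ℬ (g f))))
      (CommRingCat.ofHom (Away.map g f)) := by
  refine isPushout_of_linearIndependent _ (algebraMap_awayMap g hf hg)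
    (linearIndependent_awayMap g hf hind) (span_awayMap g hf hspan)

/-- A criterion for `Proj ℬ` to be the base change of `Proj 𝒜` along a field extension. -/
lemma isPullback_projGlue_of_span {ι : Type} (f : ι → A) (m : ι → ℕ) (hf : ∀ i, f i ∈ 𝒜 (m i))
    (hm : ∀ i, 0 < m i) (hcov : ∀ x : Proj ℬ, ∃ i, x ∈ Proj.basicOpen ℬ (g (f i)))
    (hcov' : ∀ x : Proj 𝒜, ∃ i, x ∈ Proj.basicOpen 𝒜 (f i))
    (hg : ∀ c : K, g (algebraMap K A c) = algebraMap M B (algebraMap K M c))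
    (hind : ∀ (n r : ℕ) (v : Fin r → A), (∀ i, v i ∈ 𝒜 n) → LinearIndependent K v →
      LinearIndependent M (g ∘ v))
    (hspan : ∀ i (k : ℕ), ∀ y ∈ ℬ (k • m i), y ∈ Submodule.span M (g '' (𝒜 (k • m i) : Set A))) :
    IsPullback (projGlue g f m hf hm hcov) (projToSpec ℬ) (projToSpec 𝒜)
      (Spec.map (CommRingCat.ofHom (algebraMap K M))) := by
  refine isPullback_projGlue g f m hf hm hcov _ _ _ hcov' fun i ↦ ?_
  rw [awayι_projToSpec, awayι_projToSpec]
  exact (isPullback_SpecMap_of_isPushout _ _ _ _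
    (isPushout_awayMap g (hf i) hg hind (hspan i))).flip

end Pushout

/-! ### Group actions on `Proj`. -/

section ProjAction

variable {K A G : Type} [Field K] [CommRing A] [Algebra K A] {𝒜 : ℕ → Submodule K A}
  [GradedAlgebra 𝒜] [Group G] (ρ : G →* (A ≃ₐ[K] A))
  (hρ : ∀ (g : G) (n : ℕ) (x : A), x ∈ 𝒜 n → ρ g x ∈ 𝒜 n)

/-- The graded ring homomorphism given by an element of a group acting on a graded algebra. -/
def gradedAction (g : G) : 𝒜 →+*ᵍ 𝒜 where
  __ := (ρ g : A →+* A)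
  map_mem := hρ g _ _

omit [GradedAlgebra 𝒜] in
lemma gradedAction_apply (g : G) (x : A) : gradedAction ρ hρ g x = ρ g x := rfl

lemma irrelevant_le_map_gradedAction (g : G) :
    HomogeneousIdeal.irrelevant 𝒜 ≤ (HomogeneousIdeal.irrelevant 𝒜).map (gradedAction ρ hρ g) := by
  rw [← toIdeal_le_toIdeal_iff, HomogeneousIdeal.toIdeal_irrelevant_le]
  intro i hi x hx
  have : x = gradedAction ρ hρ g (ρ g⁻¹ x) := by
    rw [gradedAction_apply, ← AlgEquiv.mul_apply, ← map_mul, mul_inv_cancel, map_one]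
    rfl
  change x ∈ (Ideal.map (gradedAction ρ hρ g) (HomogeneousIdeal.irrelevant 𝒜).toIdeal)
  rw [this]
  exact Ideal.mem_map_of_mem _ (HomogeneousIdeal.mem_irrelevant_of_mem 𝒜 hi (hρ _ _ _ hx))

/-- The endomorphism of `Proj` given by an element of a group acting on a graded algebra. -/
def projActionMap (g : G) : Proj 𝒜 ⟶ Proj 𝒜 :=
  Proj.map (gradedAction ρ hρ g) (irrelevant_le_map_gradedAction ρ hρ g)

lemma projActionMap_one : projActionMap ρ hρ 1 = 𝟙 _ := by
  rw [← Proj.map_id]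
  have : gradedAction ρ hρ 1 = .id 𝒜 := by
    ext x
    rw [gradedAction_apply, map_one]
    rfl
  simp only [projActionMap, this]

lemma projActionMap_mul (g h : G) :
    projActionMap ρ hρ (g * h) = projActionMap ρ hρ g ≫ projActionMap ρ hρ h := by
  rw [projActionMap, projActionMap, projActionMap, ← Proj.map_comp]
  have : gradedAction ρ hρ (g * h) = (gradedAction ρ hρ g).comp (gradedAction ρ hρ h) := by
    ext x
    rw [gradedAction_apply, map_mul]
    rfl
  simp only [this]

lemma projActionMap_projToSpec (g : G) :
    projActionMap ρ hρ g ≫ projToSpec 𝒜 = projToSpec 𝒜 := by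
  refine (Proj.mapAffineOpenCover (gradedAction ρ hρ g)
    (irrelevant_le_map_gradedAction ρ hρ g)).openCover.hom_ext _ _
    fun (s : Σ i : PNat, 𝒜 i) ↦ ?_
  change Proj.awayι 𝒜 (gradedAction ρ hρ g s.2) (map_mem _ s.2.2) s.1.pos ≫ _ =
    Proj.awayι 𝒜 (gradedAction ρ hρ g s.2) (map_mem _ s.2.2) s.1.pos ≫ _
  rw [projActionMap, Proj.awayι_comp_map_assoc (hi := s.1.pos) (hs := s.2.2), awayι_projToSpec,
    awayι_projToSpec, ← Spec.map_comp, ← CommRingCat.ofHom_comp]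
  congr 2
  refine RingHom.ext fun c ↦ ?_
  rw [RingHom.comp_apply, algebraMap_eq_awayMk s.2.2, Away.map_mk,
    algebraMap_eq_awayMk (map_mem (gradedAction ρ hρ g) s.2.2)]
  simp [gradedAction_apply]

/-- The action on `Proj` of a group acting on a graded algebra. -/
def projAction : G →* Aut (Over.mk (projToSpec 𝒜)) where
  toFun g := Over.isoMk
    ⟨projActionMap ρ hρ g⁻¹, projActionMap ρ hρ g,
      by rw [← projActionMap_mul, inv_mul_cancel, projActionMap_one]; rfl,
      by rw [← projActionMap_mul, mul_inv_cancel, projActionMap_one]; rfl⟩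
    (projActionMap_projToSpec ρ hρ g⁻¹)
  map_one' := by
    ext : 2
    change projActionMap ρ hρ 1⁻¹ = 𝟙 _
    rw [inv_one, projActionMap_one]
  map_mul' g h := by
    ext : 2
    change projActionMap ρ hρ (g * h)⁻¹ = projActionMap ρ hρ h⁻¹ ≫ projActionMap ρ hρ g⁻¹
    rw [mul_inv_rev, projActionMap_mul]

lemma awayι_comp_projActionMap {m : ℕ} (hm : 0 < m) {f f' : A} (hf : f ∈ 𝒜 m) (hf' : f' ∈ 𝒜 m)
    {g : G} (e : ρ g f = f') :
    Proj.awayι 𝒜 f' hf' hm ≫ projActionMap ρ hρ g =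
      Spec.map (CommRingCat.ofHom (HomogeneousLocalization.map (gradedAction ρ hρ g)
        (P := .powers f) (Q := .powers f')
        (by rintro _ ⟨n, rfl⟩; exact ⟨n, by simp [← e, gradedAction_apply]⟩))) ≫
        Proj.awayι 𝒜 f hf hm := by
  subst e
  exact Proj.awayι_comp_map (gradedAction ρ hρ g) _ hm f hf

/-- A trivial action on `Proj` fixes the fractions x / f of degree zero. Since f itself is fixed, so
is x; without such an f, x would be known only up to a common factor. -/
lemma eq_of_projAction_eq_one [IsDomain A] {g : G} (hg : projAction ρ hρ g = 1) {m : ℕ}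
    (hm : 0 < m) {f : A} (hf0 : f ≠ 0) (hf : f ∈ 𝒜 m) (e : ρ g f = f) {x : A} (hx : x ∈ 𝒜 m) :
    ρ g x = x := by
  have h1 : projActionMap ρ hρ g = 𝟙 _ := congr(($hg).inv.left)
  have h2 := awayι_comp_projActionMap ρ hρ hm hf hf e
  rw [h1, Category.comp_id] at h2
  have h3 := (cancel_mono (Proj.awayι 𝒜 f hf hm)).mp ((Category.id_comp _).trans h2)
  rw [← Spec.map_id, Spec.map_inj] at h3
  have h4 := congr(($h3).hom (Away.mk 𝒜 hf 1 x (by simpa using hx))).symm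
  replace h4 := congr(($h4).val)
  change Localization.mk (ρ g x) ⟨_, _⟩ = Localization.mk x ⟨_, _⟩ at h4
  rw [Localization.mk_eq_mk_iff, Localization.r_iff_exists] at h4
  obtain ⟨⟨_, k, rfl⟩, hk⟩ := h4
  change f ^ k * (f ^ 1 * ρ g x) = f ^ k * (ρ g (f ^ 1) * x) at hk
  rw [pow_one, e] at hk
  exact mul_left_cancel₀ hf0 (mul_left_cancel₀ (pow_ne_zero k hf0) hk)

end ProjAction

/-! ### Rational points of `Proj`. -/

section Points

variable {K A : Type} [Field K] [CommRing A] [Algebra K A] {𝒜 : ℕ → Submodule K A}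
  [GradedAlgebra 𝒜]

lemma exists_algHom_of_section (s : Spec (.of K) ⟶ Proj 𝒜) (hs : s ≫ projToSpec 𝒜 = 𝟙 _)
    {ι : Type} (f : ι → A) (m : ι → ℕ) (hf : ∀ i, f i ∈ 𝒜 (m i)) (hm : ∀ i, 0 < m i)
    (hcov : ∀ x : Proj 𝒜, ∃ i, x ∈ Proj.basicOpen 𝒜 (f i)) :
    ∃ i, Nonempty (Away 𝒜 (f i) →ₐ[K] K) := by
  let x : Spec (.of K) := default
  obtain ⟨i, hi⟩ := hcov (s x)
  have h1 : Set.range s ⊆ Set.range (Proj.awayι 𝒜 (f i) (hf i) (hm i)) := by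
    rintro _ ⟨y, rfl⟩
    rw [Subsingleton.elim y x]
    rw [← Proj.opensRange_awayι 𝒜 (f i) (hf i) (hm i)] at hi
    exact hi
  let t := IsOpenImmersion.lift (Proj.awayι 𝒜 (f i) (hf i) (hm i)) s h1
  have h2 : t ≫ Proj.awayι 𝒜 (f i) (hf i) (hm i) = s := IsOpenImmersion.lift_fac _ _ _
  obtain ⟨e, he⟩ := Spec.map_surjective t
  refine ⟨i, ⟨{ e.hom with commutes' := fun c ↦ ?_ }⟩⟩
  rw [← h2, Category.assoc, awayι_projToSpec, ← he, ← Spec.map_comp, ← Spec.map_id,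
    Spec.map_inj] at hs
  exact congr(($hs).hom c)

lemma exists_section_of_algHom {m : ℕ} (hm : 0 < m) {f : A} (hf : f ∈ 𝒜 m)
    (e : Away 𝒜 f →ₐ[K] K) : ∃ s : Spec (.of K) ⟶ Proj 𝒜, s ≫ projToSpec 𝒜 = 𝟙 _ := by
  refine ⟨Spec.map (CommRingCat.ofHom e.toRingHom) ≫ Proj.awayι 𝒜 f hf hm, ?_⟩
  rw [Category.assoc, awayι_projToSpec, ← Spec.map_comp, ← Spec.map_id]
  congr 1
  ext c
  exact e.commutes c

lemma exists_section_projectivePlane (K : Type) [Field K] :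
    ∃ s : Spec (.of K) ⟶ (projectivePlane K).left, s ≫ (projectivePlane K).hom = 𝟙 _ := by
  let _ := MvPolynomial.gradedAlgebra (σ := Fin 3) (R := K)
  -- The rational point (1 : 0 : 0), in the chart where X₀ is invertible.
  let v : MvPolynomial (Fin 3) K →ₐ[K] K := MvPolynomial.aeval ![1, 0, 0]
  have hv : IsUnit (v (MvPolynomial.X 0)) := by simp [v]
  let w : Localization.Away (MvPolynomial.X 0 : MvPolynomial (Fin 3) K) →+* K :=
    IsLocalization.Away.lift (MvPolynomial.X 0) (g := v.toRingHom) hv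
  refine exists_section_of_algHom (𝒜 := MvPolynomial.homogeneousSubmodule (Fin 3) K)
    one_pos (MvPolynomial.isHomogeneous_X K 0)
    { w.comp (algebraMap (Away (MvPolynomial.homogeneousSubmodule (Fin 3) K) _) _) with
      commutes' := fun c ↦ ?_ }
  change w (algebraMap _ _ (algebraMap K (MvPolynomial (Fin 3) K) c)) = c
  exact (IsLocalization.Away.lift_eq _ hv _).trans (v.commutes c)

end Points

end Proj

/-! ### Galois descent for a cyclic group of order three. -/

section CubicDescent

variable {K L : Type} [Field K] [Field L] [Algebra K L] (σ : L ≃ₐ[K] L)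

/-- The first three powers of an automorphism are linearly independent if they are distinct. -/
lemma eq_zero_of_cubic_combination (h3 : ∀ x, σ (σ (σ x)) = x) (h1 : ∃ x, σ x ≠ x) (d : Fin 3 → L)
    (hd : ∀ x, d 0 * x + d 1 * σ x + d 2 * σ (σ x) = 0) : d = 0 := by
  let χ : Fin 3 → L →* L := ![MonoidHom.id L, (σ : L →* L), (σ : L →* L).comp (σ : L →* L)]
  obtain ⟨x, hx⟩ := h1
  have hχ : Function.Injective χ := by
    have h01 : χ 0 ≠ χ 1 := fun h ↦ hx congr($h x).symm
    have h12 : χ 1 ≠ χ 2 := fun h ↦ hx (σ.injective congr($h x)).symm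
    have h02 : χ 0 ≠ χ 2 := fun h ↦ hx <| by
      have : x = σ (σ x) := congr($h x)
      conv_rhs => rw [← h3 x, ← this]
    intro i j hij
    fin_cases i <;> fin_cases j
    exacts [rfl, absurd hij h01, absurd hij h02, absurd hij.symm h01, rfl, absurd hij h12,
      absurd hij.symm h02, absurd hij.symm h12, rfl]
  have := (linearIndependent_monoidHom L L).comp χ hχ
  rw [Fintype.linearIndependent_iff] at this
  funext i
  refine this d ?_ i
  funext x
  simpa [Fin.sum_univ_three, χ] using hd x

lemma exists_cubic_trace_ne_zero (h3 : ∀ x, σ (σ (σ x)) = x) (h1 : ∃ x, σ x ≠ x) :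
    ∃ x, x + σ x + σ (σ x) ≠ 0 := by
  by_contra! h
  have := congr($(eq_zero_of_cubic_combination σ h3 h1 1 (by simpa using h)) 0)
  simp at this

/-- The vectors (c, σ c, σ² c) span L³: a functional vanishing on all of them would be a linear
relation between 1, σ and σ². So (1, 0, 0) is a combination of them. -/
lemma exists_cubic_dual (h3 : ∀ x, σ (σ (σ x)) = x) (h1 : ∃ x, σ x ≠ x) :
    ∃ d : L →₀ L, (d.sum fun c l ↦ l * c) = 1 ∧ (d.sum fun c l ↦ l * σ c) = 0 ∧
      (d.sum fun c l ↦ l * σ (σ c)) = 0 := by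
  let v : L → Fin 3 → L := fun c ↦ ![c, σ c, σ (σ c)]
  have htop : Submodule.span L (Set.range v) = ⊤ := by
    by_contra h
    obtain ⟨f, hf0, hf⟩ := Submodule.exists_le_ker_of_lt_top _ (lt_top_iff_ne_top.mpr h)
    apply hf0
    have : (fun i ↦ f (Pi.single i 1)) = 0 := by
      refine eq_zero_of_cubic_combination σ h3 h1 _ fun x ↦ ?_
      have hx : f (v x) = 0 := hf (Submodule.subset_span ⟨x, rfl⟩)
      have hv : v x = x • Pi.single 0 1 + σ x • Pi.single 1 1 + σ (σ x) • Pi.single 2 1 := by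
        funext i
        fin_cases i <;> simp [v]
      rw [hv, map_add, map_add, map_smul, map_smul, map_smul, smul_eq_mul, smul_eq_mul,
        smul_eq_mul] at hx
      rw [← hx]
      ring
    refine (Pi.basisFun L (Fin 3)).ext fun i ↦ ?_
    simpa using congr($this i)
  have h : (Pi.single 0 1 : Fin 3 → L) ∈ Submodule.span L (Set.range v) := htop ▸ trivial
  rw [Finsupp.mem_span_range_iff_exists_finsupp] at h
  obtain ⟨d, hd⟩ := h
  refine ⟨d, ?_, ?_, ?_⟩
  · simpa [v, Finsupp.sum, Finset.sum_apply] using congr($hd 0)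
  · simpa [v, Finsupp.sum, Finset.sum_apply] using congr($hd 1)
  · simpa [v, Finsupp.sum, Finset.sum_apply] using congr($hd 2)

variable {W : Type} [AddCommGroup W] [Module L W] (T : W →+ W) (hT : ∀ c w, T (c • w) = σ c • T w)

include hT in
/-- Descent for semilinear actions of a cyclic group of order three: spanning. -/
lemma mem_span_fixed (h3 : ∀ x, σ (σ (σ x)) = x) (h1 : ∃ x, σ x ≠ x) {w : W}
    (hw : T (T (T w)) = w) :
    w ∈ Submodule.span L
      {u | T u = u ∧ u ∈ Submodule.span L {w, T w, T (T w)}} := by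
  obtain ⟨d, hd0, hd1, hd2⟩ := exists_cubic_dual σ h3 h1
  -- The dual family recovers w from the traces c w + T (c w) + T² (c w), each of which is fixed by
  -- T.
  have key : w = d.sum fun c l ↦ l • (c • w + σ c • T w + σ (σ c) • T (T w)) := by
    simp only [smul_add, smul_smul, Finsupp.sum, Finset.sum_add_distrib, ← Finset.sum_smul]
    simp only [Finsupp.sum] at hd0 hd1 hd2
    simp [hd0, hd1, hd2]
  suffices h : (d.sum fun c l ↦ l • (c • w + σ c • T w + σ (σ c) • T (T w))) ∈
      Submodule.span L {u | T u = u ∧ u ∈ Submodule.span L {w, T w, T (T w)}} by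
    rwa [← key] at h
  refine Submodule.sum_mem _ fun c _ ↦ Submodule.smul_mem _ _ (Submodule.subset_span ⟨?_, ?_⟩)
  · simp only [map_add, hT, h3, hw]
    abel
  · refine add_mem (add_mem ?_ ?_) ?_ <;>
    exact Submodule.smul_mem _ _ (Submodule.subset_span (by simp))

include hT in
/-- Descent for semilinear actions of a cyclic group of order three: independence. -/
lemma linearIndependent_fixed [Module K W] [IsScalarTower K L W] (h3 : ∀ x, σ (σ (σ x)) = x)
    (h1 : ∃ x, σ x ≠ x) (hfix : ∀ x, σ x = x → ∃ y, algebraMap K L y = x)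
    {r : ℕ} (v : Fin r → W) (hv : ∀ i, T (v i) = v i) (hK : LinearIndependent K v) :
    LinearIndependent L v := by
  obtain ⟨t, ht⟩ := exists_cubic_trace_ne_zero σ h3 h1
  rw [Fintype.linearIndependent_iff] at hK ⊢
  intro l hl i
  by_contra hi
  -- The trace of c times the relation has coefficients in K. With c = t / l i, its i-th coefficient
  -- is the trace of t, which is nonzero, against independence over K.
  have h2 (c : L) : ∑ j, (c * l j + σ (c * l j) + σ (σ (c * l j))) • v j = 0 := by
    have e0 : ∑ j, (c * l j) • v j = 0 := by
      simp only [mul_smul, ← Finset.smul_sum, hl, smul_zero]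
    have e1 : ∑ j, σ (c * l j) • v j = 0 := by
      have := congr(T $e0)
      rw [map_sum, map_zero] at this
      rw [← this]
      exact Finset.sum_congr rfl fun j _ ↦ by rw [hT, hv]
    have e2 : ∑ j, σ (σ (c * l j)) • v j = 0 := by
      have := congr(T $e1)
      rw [map_sum, map_zero] at this
      rw [← this]
      exact Finset.sum_congr rfl fun j _ ↦ by rw [hT, hv]
    simp only [add_smul, Finset.sum_add_distrib, e0, e1, e2, add_zero]
  have h4 (x : L) : ∃ y, algebraMap K L y = x + σ x + σ (σ x) :=
    hfix _ (by simp only [map_add, h3]; ring)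
  choose tr htr using h4
  have h5 := hK (fun j ↦ tr (t / l i * l j)) (by
    have := h2 (t / l i)
    simp_rw [← htr, algebraMap_smul] at this
    exact this) i
  apply ht
  rw [← htr, ← div_mul_cancel₀ t hi, h5, map_zero]

end CubicDescent

section BaseChangeMvPolynomial

/-- Over a field, independence means that the map from the free module has a left inverse, and a
left inverse survives tensoring with M. -/
lemma linearIndependent_map_mvPolynomial {L M σ : Type} [Field L] [Field M] (j : L →+* M) {r : ℕ}
    {v : Fin r → MvPolynomial σ L} (hv : LinearIndependent L v) :
    LinearIndependent M fun i ↦ MvPolynomial.map j (v i) := by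
  let _ := j.toAlgebra
  obtain ⟨q, hq⟩ := LinearMap.exists_leftInverse_of_injective
    (Finsupp.linearCombination L v) (LinearMap.ker_eq_bot.mpr hv)
  rw [Fintype.linearIndependent_iff]
  intro c hc i
  have h1 : ∑ i, c i ⊗ₜ[L] v i = (0 : TensorProduct L M (MvPolynomial σ L)) := by
    apply (MvPolynomial.algebraTensorAlgEquiv (σ := σ) L M).injective
    rw [map_sum, map_zero, ← hc]
    exact Finset.sum_congr rfl fun i _ ↦ MvPolynomial.algebraTensorAlgEquiv_tmul ..
  have h2 := congr(TensorProduct.rid L M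
    (LinearMap.lTensor M ((Finsupp.lapply i : (Fin r →₀ L) →ₗ[L] L) ∘ₗ q) $h1))
  have h3 (k : Fin r) : q (v k) = Finsupp.single k 1 := by
    simpa using congr($hq (Finsupp.single k 1))
  simpa [h3, Finsupp.single_apply] using h2

end BaseChangeMvPolynomial

/-! ### The twisted plane and its splitting. -/

/-- A cyclic cubic extension `L/K` with a generator `σ` of its Galois group, and a nonzero element
of `K`: the data defining a cyclic algebra of degree three over `K`. -/
structure CubicDatum (K L : Type) [Field K] [Field L] [Algebra K L] where
  /-- the generator of the Galois group -/
  σ : L ≃ₐ[K] L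
  σ_pow_three : ∀ x, σ (σ (σ x)) = x
  σ_nontrivial : ∃ x, σ x ≠ x
  fixed : ∀ x, σ x = x → ∃ y, algebraMap K L y = x
  /-- the constant defining the cyclic algebra -/
  a : K
  a_ne_zero : a ≠ 0

namespace CubicDatum

open MvPolynomial

variable {K L : Type} [Field K] [Field L] [Algebra K L] (D : CubicDatum K L)

/-- The coefficients of the cyclic substitution `X₀ ↦ X₁ ↦ X₂ ↦ a X₀`. -/
def coef (i : Fin 3) : L := if i = 2 then algebraMap K L D.a else 1

/-- The semilinear endomorphism of `L[X₀, X₁, X₂]` which acts by `σ` on the coefficients and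
by `X₀ ↦ X₁ ↦ X₂ ↦ a X₀` on the variables. -/
def twist : MvPolynomial (Fin 3) L →+* MvPolynomial (Fin 3) L :=
  eval₂Hom (C.comp (D.σ : L →+* L)) fun i ↦ C (D.coef i) * X (i + 1)

@[simp] lemma twist_C (c : L) : D.twist (C c) = C (D.σ c) := by simp [twist]

@[simp] lemma twist_X (i : Fin 3) : D.twist (X i) = C (D.coef i) * X (i + 1) := by simp [twist]

lemma twist_smul (c : L) (p : MvPolynomial (Fin 3) L) :
    D.twist (c • p) = D.σ c • D.twist p := by
  rw [smul_eq_C_mul, map_mul, twist_C, smul_eq_C_mul]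

lemma σ_coef (i : Fin 3) : D.σ (D.coef i) = D.coef i := by
  rw [coef]; split_ifs <;> simp

lemma isHomogeneous_twist {p : MvPolynomial (Fin 3) L} {n : ℕ} (hp : p.IsHomogeneous n) :
    (D.twist p).IsHomogeneous n := by
  rw [← one_mul n]
  refine hp.eval₂ _ _ (fun c ↦ ?_) fun i ↦ ?_
  · exact isHomogeneous_C _ _
  · exact isHomogeneous_C_mul_X _ _

/-- Three steps multiply every variable by a, hence a form of degree n by a^n. -/
lemma twist_twist_twist {p : MvPolynomial (Fin 3) L} {n : ℕ} (hp : p.IsHomogeneous n) :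
    D.twist (D.twist (D.twist p)) = algebraMap K L D.a ^ n • p := by
  have h1 : (D.twist.comp D.twist).comp D.twist =
      eval₂Hom C fun i ↦ C (algebraMap K L D.a) * X i := by
    refine ringHom_ext (fun c ↦ by simp [D.σ_pow_three]) fun i ↦ ?_
    simp only [RingHom.comp_apply, twist_X, map_mul, twist_C, σ_coef, eval₂Hom_X']
    fin_cases i <;> simp [coef, mul_comm]
  change ((D.twist.comp D.twist).comp D.twist) p = _
  rw [h1]
  conv_lhs => rw [p.as_sum]
  conv_rhs => rw [p.as_sum]
  rw [map_sum, Finset.smul_sum]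
  refine Finset.sum_congr rfl fun d hd ↦ ?_
  rw [coe_eval₂Hom, eval₂_monomial, Finsupp.prod]
  simp only [mul_pow, Finset.prod_mul_distrib, Finset.prod_pow_eq_pow_sum]
  rw [monomial_eq, hp.degree_eq_sum_deg_support hd, smul_eq_C_mul,
    Finsupp.prod, C_pow]
  ring

/-- The forms of degree `n` which descend to the twisted form of the projective plane. They vanish
unless `n` is a multiple of three. -/
def form (n : ℕ) : Submodule K (MvPolynomial (Fin 3) L) where
  -- The truncated quotient n / 3 is harmless: in degrees where it is not exact only zero is
  -- allowed.
  carrier := {p | p.IsHomogeneous n ∧ (¬ 3 ∣ n → p = 0) ∧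
    D.twist p = algebraMap K L D.a ^ (n / 3) • p}
  zero_mem' := ⟨isHomogeneous_zero _ _ _, fun _ ↦ rfl, by simp⟩
  add_mem' := fun ⟨h1, h2, h3⟩ ⟨h1', h2', h3'⟩ ↦
    ⟨h1.add h1', fun h ↦ by rw [h2 h, h2' h, add_zero], by rw [map_add, h3, h3', smul_add]⟩
  smul_mem' := fun c p ⟨h1, h2, h3⟩ ↦ by
    rw [← algebraMap_smul L c p]
    refine ⟨(homogeneousSubmodule (Fin 3) L n).smul_mem _ h1, fun h ↦ by rw [h2 h, smul_zero], ?_⟩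
    rw [twist_smul, h3, AlgEquiv.commutes, smul_comm]

lemma one_mem_form : 1 ∈ D.form 0 := ⟨isHomogeneous_one _ _, by simp, by simp⟩

lemma mul_mem_form {m n : ℕ} {p q : MvPolynomial (Fin 3) L} (hp : p ∈ D.form m)
    (hq : q ∈ D.form n) : p * q ∈ D.form (m + n) := by
  obtain ⟨h1, h2, h3⟩ := hp
  obtain ⟨h1', h2', h3'⟩ := hq
  by_cases hm : 3 ∣ m
  · by_cases hn : 3 ∣ n
    · refine ⟨h1.mul h1', fun h ↦ absurd (dvd_add hm hn) h, ?_⟩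
      rw [map_mul, h3, h3', Nat.add_div_of_dvd_right hm, pow_add, smul_mul_smul_comm]
    · rw [h2' hn, mul_zero]
      exact zero_mem _
  · rw [h2 hm, zero_mul]
    exact zero_mem _

/-- The homogeneous coordinate ring of the twisted form of the projective plane, in its
anticanonical embedding. -/
def ring : Subalgebra K (MvPolynomial (Fin 3) L) :=
  (⨆ n, D.form n).toSubalgebra (Submodule.mem_iSup_of_mem 0 D.one_mem_form) <| by
    intro p q hp hq
    induction hp using Submodule.iSup_induction' with
    | zero => rw [zero_mul]; exact zero_mem _
    | add x y _ _ hx hy => rw [add_mul]; exact add_mem hx hy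
    | mem m p hp =>
      induction hq using Submodule.iSup_induction' with
      | zero => rw [mul_zero]; exact zero_mem _
      | add x y _ _ hx hy => rw [mul_add]; exact add_mem hx hy
      | mem n q hq => exact Submodule.mem_iSup_of_mem _ (D.mul_mem_form hp hq)

lemma form_le_ring (n : ℕ) : D.form n ≤ Subalgebra.toSubmodule D.ring := by
  rw [ring, Submodule.toSubalgebra_toSubmodule]
  exact le_iSup D.form n

/-- The grading of the coordinate ring. -/
def grading (n : ℕ) : Submodule K D.ring := (D.form n).comap D.ring.val.toLinearMap

lemma mem_grading {n : ℕ} {p : D.ring} : p ∈ D.grading n ↔ (p : MvPolynomial (Fin 3) L) ∈ D.form n :=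
  Iff.rfl

lemma isInternal_grading : DirectSum.IsInternal D.grading := by
  rw [DirectSum.isInternal_submodule_iff_iSupIndep_and_iSup_eq_top]
  constructor
  · rw [iSupIndep_iff_finsetSum_eq_zero_imp_eq_zero]
    intro s v hv hs i hi
    have h1 := congr(homogeneousComponent i (($hs : D.ring) : MvPolynomial (Fin 3) L))
    rw [AddSubmonoidClass.coe_finsetSum, map_sum, Finset.sum_eq_single_of_mem i hi] at h1
    · rw [homogeneousComponent_eq_self (D.mem_grading.mp (hv i hi)).1] at h1
      exact Subtype.ext (by simpa using h1)
    · intro j hj hji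
      rw [homogeneousComponent_of_mem (D.mem_grading.mp (hv j hj)).1, if_neg hji.symm]
  · rw [eq_top_iff]
    rintro ⟨p, hp⟩ -
    induction hp using Submodule.iSup_induction' with
    | zero => exact zero_mem _
    | add x y hx hy hx' hy' => exact add_mem hx' hy'
    | mem n p hp => exact Submodule.mem_iSup_of_mem n hp

instance : SetLike.GradedMonoid D.grading where
  one_mem := D.one_mem_form
  mul_mem _ _ _ _ hp hq := D.mul_mem_form hp hq

instance : GradedAlgebra D.grading where
  toDecomposition := D.isInternal_grading.chooseDecomposition

/-- The twist, normalized so as to have order three in a degree divisible by three. -/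
def normalizedTwist (n : ℕ) : MvPolynomial (Fin 3) L →+ MvPolynomial (Fin 3) L :=
  (DistribSMul.toAddMonoidHom _ ((algebraMap K L D.a ^ (n / 3))⁻¹)).comp D.twist.toAddMonoidHom

lemma normalizedTwist_apply (n : ℕ) (p : MvPolynomial (Fin 3) L) :
    D.normalizedTwist n p = (algebraMap K L D.a ^ (n / 3))⁻¹ • D.twist p := rfl

lemma normalizedTwist_smul (n : ℕ) (c : L) (p : MvPolynomial (Fin 3) L) :
    D.normalizedTwist n (c • p) = D.σ c • D.normalizedTwist n p := by
  rw [normalizedTwist_apply, twist_smul, smul_comm, normalizedTwist_apply]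

lemma algebraMap_a_ne_zero : algebraMap K L D.a ≠ 0 := by simpa using D.a_ne_zero

lemma normalizedTwist_eq_self_iff (n : ℕ) (p : MvPolynomial (Fin 3) L) :
    D.normalizedTwist n p = p ↔ D.twist p = algebraMap K L D.a ^ (n / 3) • p := by
  rw [normalizedTwist_apply, inv_smul_eq_iff₀ (pow_ne_zero _ D.algebraMap_a_ne_zero)]

lemma linearIndependent_form {n r : ℕ} {v : Fin r → MvPolynomial (Fin 3) L}
    (hv : ∀ i, v i ∈ D.form n) (hK : LinearIndependent K v) : LinearIndependent L v :=
  linearIndependent_fixed D.σ (D.normalizedTwist n) (D.normalizedTwist_smul n) D.σ_pow_three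
    D.σ_nontrivial D.fixed v (fun i ↦ (D.normalizedTwist_eq_self_iff n _).mpr (hv i).2.2) hK

lemma mem_span_form {n : ℕ} (hn : 3 ∣ n) {p : MvPolynomial (Fin 3) L} (hp : p.IsHomogeneous n) :
    p ∈ Submodule.span L (D.form n : Set (MvPolynomial (Fin 3) L)) := by
  have h1 (q : MvPolynomial (Fin 3) L) (hq : q.IsHomogeneous n) :
      (D.normalizedTwist n q).IsHomogeneous n :=
    (homogeneousSubmodule (Fin 3) L n).smul_mem _ (D.isHomogeneous_twist hq)
  refine Submodule.span_mono ?_ (mem_span_fixed D.σ (D.normalizedTwist n)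
    (D.normalizedTwist_smul n) D.σ_pow_three D.σ_nontrivial (w := p) ?_)
  · rintro u ⟨hu, hu'⟩
    refine ⟨?_, fun h ↦ absurd hn h, (D.normalizedTwist_eq_self_iff n u).mp hu⟩
    rw [← mem_homogeneousSubmodule]
    refine Submodule.span_le.mpr ?_ hu'
    rintro _ (rfl | rfl | rfl)
    exacts [hp, h1 _ hp, h1 _ (h1 _ hp)]
  · obtain ⟨m, rfl⟩ := hn
    simp only [normalizedTwist_apply, twist_smul, map_mul, map_inv₀, map_pow, AlgEquiv.commutes, smul_smul,
      D.twist_twist_twist hp]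
    rw [Nat.mul_div_cancel_left _ (by norm_num)]
    convert one_smul L p
    have := D.algebraMap_a_ne_zero
    field_simp
    rw [← pow_mul, mul_comm]

section BaseChange

variable {M : Type} [Field M] [Algebra K M] (j : L →ₐ[K] M)

attribute [local instance] MvPolynomial.gradedAlgebra

/-- The coordinate ring of the twisted form, inside a polynomial ring over an extension which
splits it. -/
def toPolynomial : D.grading →+*ᵍ homogeneousSubmodule (Fin 3) M where
  __ := (MvPolynomial.map (j : L →+* M)).comp (D.ring.val : D.ring →+* MvPolynomial (Fin 3) L)
  map_mem := fun h ↦ IsHomogeneous.map h.1 _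

lemma toPolynomial_apply (p : D.ring) :
    D.toPolynomial j p = MvPolynomial.map (j : L →+* M) (p : MvPolynomial (Fin 3) L) := rfl

lemma toPolynomial_algebraMap (c : K) :
    D.toPolynomial j (algebraMap K D.ring c) =
      algebraMap M (MvPolynomial (Fin 3) M) (algebraMap K M c) := by
  change MvPolynomial.map (j : L →+* M) (C (algebraMap K L c)) = _
  rw [map_C]
  simp [algebraMap_eq]

lemma linearIndependent_toPolynomial (n r : ℕ) (v : Fin r → D.ring) (hv : ∀ i, v i ∈ D.grading n)
    (hK : LinearIndependent K v) : LinearIndependent M (D.toPolynomial j ∘ v) :=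
  linearIndependent_map_mvPolynomial (j : L →+* M) (D.linearIndependent_form (n := n) hv
    (hK.map' D.ring.val.toLinearMap (LinearMap.ker_eq_bot.mpr Subtype.val_injective)))

lemma mem_span_toPolynomial {n : ℕ} (hn : 3 ∣ n) {p : MvPolynomial (Fin 3) M}
    (hp : p.IsHomogeneous n) :
    p ∈ Submodule.span M (D.toPolynomial j '' (D.grading n : Set D.ring)) := by
  have h1 (q : MvPolynomial (Fin 3) L) (hq : q ∈ Submodule.span L (D.form n : Set _)) :
      MvPolynomial.map (j : L →+* M) q ∈
        Submodule.span M (D.toPolynomial j '' (D.grading n : Set D.ring)) := by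
    induction hq using Submodule.span_induction with
    | zero => rw [map_zero]; exact zero_mem _
    | add x y _ _ hx hy => rw [map_add]; exact add_mem hx hy
    | smul c x _ hx =>
      rw [smul_eq_C_mul, map_mul, map_C, ← smul_eq_C_mul]
      exact Submodule.smul_mem _ _ hx
    | mem x hx => exact Submodule.subset_span ⟨⟨x, D.form_le_ring n hx⟩, hx, rfl⟩
  rw [p.as_sum]
  refine Submodule.sum_mem _ fun d hd ↦ ?_
  have h2 : monomial d (coeff d p) =
      coeff d p • MvPolynomial.map (j : L →+* M) (monomial d 1) := by
    rw [map_monomial, map_one, smul_monomial, smul_eq_mul, mul_one]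
  rw [h2]
  exact Submodule.smul_mem _ _ (h1 _ (D.mem_span_form hn
    (isHomogeneous_monomial _ (hp.degree_eq_sum_deg_support hd).symm)))

end BaseChange

/-- The index set of a standard affine cover. -/
abbrev CoverIndex : Type := Σ n : ℕ, D.grading (3 * (n + 1))

/-- The elements defining the standard affine cover. -/
abbrev coverElem (i : D.CoverIndex) : D.ring := i.2

/-- The degrees of the elements defining the standard affine cover. -/
abbrev coverDegree (i : D.CoverIndex) : ℕ := 3 * (i.1 + 1)

lemma coverElem_mem (i : D.CoverIndex) : D.coverElem i ∈ D.grading (D.coverDegree i) := i.2.2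

lemma coverDegree_pos (i : D.CoverIndex) : 0 < D.coverDegree i := by positivity

lemma exists_mem_basicOpen_coverElem (x : Proj D.grading) :
    ∃ i, x ∈ Proj.basicOpen D.grading (D.coverElem i) := by
  by_contra! h
  refine x.not_irrelevant_le ?_
  rw [← toIdeal_le_toIdeal_iff, HomogeneousIdeal.toIdeal_irrelevant_le]
  intro n hn p hp
  by_cases h3 : 3 ∣ n
  · obtain ⟨m, rfl⟩ := h3
    obtain ⟨m, rfl⟩ := Nat.exists_eq_succ_of_ne_zero (show m ≠ 0 by rintro rfl; simp at hn)
    simpa using h ⟨m, p, hp⟩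
  · have : p = 0 := Subtype.ext ((D.mem_grading.mp hp).2.1 h3)
    rw [this]
    exact zero_mem _

section BaseChange

variable {M : Type} [Field M] [Algebra K M] (j : L →ₐ[K] M)

attribute [local instance] MvPolynomial.gradedAlgebra

/-- Degree three suffices: the cubes Xᵢ³ are combinations of descended forms, so a prime containing
all of these contains every Xᵢ. -/
lemma exists_mem_basicOpen_toPolynomial (x : Proj (homogeneousSubmodule (Fin 3) M)) :
    ∃ i, x ∈ Proj.basicOpen (homogeneousSubmodule (Fin 3) M)
      (D.toPolynomial j (D.coverElem i)) := by
  by_contra! h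
  have hX (i : Fin 3) : (X i : MvPolynomial (Fin 3) M) ∈ x.asHomogeneousIdeal.toIdeal := by
    refine x.isPrime.mem_of_pow_mem 3 ?_
    have h1 := D.mem_span_toPolynomial j (dvd_refl 3) (isHomogeneous_X_pow (R := M) i 3)
    have h2 : Submodule.span M (D.toPolynomial j '' (D.grading 3 : Set D.ring)) ≤
        x.asHomogeneousIdeal.toIdeal.restrictScalars M := by
      rw [Submodule.span_le]
      rintro _ ⟨p, hp, rfl⟩
      simpa using h ⟨0, p, hp⟩
    exact h2 h1
  refine x.not_irrelevant_le ?_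
  rw [← toIdeal_le_toIdeal_iff, HomogeneousIdeal.toIdeal_irrelevant_le]
  intro n hn p hp
  rw [p.as_sum]
  refine Ideal.sum_mem _ fun d hd ↦ ?_
  have hd0 : d ≠ 0 := by
    rintro rfl
    have := hp.degree_eq_sum_deg_support hd
    simp at this
    omega
  obtain ⟨i, hi⟩ := Finsupp.ne_iff.mp hd0
  exact Ideal.mem_of_dvd _ (X_dvd_monomial.mpr (Or.inr hi)) (hX i)

/-- The twisted form becomes isomorphic to the projective plane over any extension of `L`. -/
lemma isPullback_toPolynomial :
    CategoryTheory.IsPullback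
      (projGlue (D.toPolynomial j) D.coverElem D.coverDegree D.coverElem_mem D.coverDegree_pos
        (D.exists_mem_basicOpen_toPolynomial j))
      (projToSpec (homogeneousSubmodule (Fin 3) M)) (projToSpec D.grading)
      (Spec.map (CommRingCat.ofHom (algebraMap K M))) :=
  isPullback_projGlue_of_span _ _ _ _ _ _ D.exists_mem_basicOpen_coverElem
    (D.toPolynomial_algebraMap j) (D.linearIndependent_toPolynomial j)
    fun _ _ _ hy ↦ D.mem_span_toPolynomial j (Dvd.dvd.mul_left (dvd_mul_right _ _) _) hy

end BaseChange

/-- The twisted form of the projective plane attached to a cyclic algebra of degree three. -/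
def severiBrauer : Over (Spec (CommRingCat.of K)) := Over.mk (projToSpec D.grading)

lemma isSeveriBrauerSurface [Algebra.IsAlgebraic K L] :
    IsSeveriBrauerSurface K D.severiBrauer := by
  let j : L →ₐ[K] AlgebraicClosure K := IsAlgClosed.lift
  have h := D.isPullback_toPolynomial j
  exact ⟨(Over.isoMk h.isoPullback h.isoPullback_hom_snd).symm⟩

end CubicDatum

/-! ### A rational point makes the constant a norm. -/

namespace CubicDatum

open MvPolynomial HomogeneousLocalization Graded

attribute [local instance] MvPolynomial.gradedAlgebra

variable {K L : Type} [Field K] [Field L] [Algebra K L] (D : CubicDatum K L)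

/-- A `K`-point of an affine chart of the twisted form gives an `L`-point of a chart of the
projective plane. -/
lemma exists_ringHom_away (i : D.CoverIndex) (e : Away D.grading (D.coverElem i) →ₐ[K] K) :
    ∃ ψ : Away (homogeneousSubmodule (Fin 3) L) (D.toPolynomial (AlgHom.id K L) (D.coverElem i))
      →+* L, (∀ c, ψ (algebraMap L _ c) = c) ∧
      ∀ z, ψ (Away.map (D.toPolynomial (AlgHom.id K L)) (D.coverElem i) z) =
        algebraMap K L (e z) := by
  have h := isPushout_awayMap (D.toPolynomial (AlgHom.id K L)) (D.coverElem_mem i)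
    (D.toPolynomial_algebraMap _) (D.linearIndependent_toPolynomial _)
    fun k _ hy ↦ D.mem_span_toPolynomial _ (Dvd.dvd.mul_left (dvd_mul_right _ _) _) hy
  have hw : CommRingCat.ofHom (algebraMap K L) ≫ 𝟙 (CommRingCat.of L) =
      CommRingCat.ofHom (algebraMap K (Away D.grading (D.coverElem i))) ≫
        CommRingCat.ofHom ((algebraMap K L).comp e.toRingHom) := by
    ext c
    exact congr(algebraMap K L $(e.commutes c)).symm
  exact ⟨(h.desc _ _ hw).hom, fun c ↦ congr(($(h.inl_desc _ _ hw)).hom c),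
    fun z ↦ congr(($(h.inr_desc _ _ hw)).hom z)⟩

lemma toPolynomial_id_apply (p : D.ring) :
    D.toPolynomial (AlgHom.id K L) p = (p : MvPolynomial (Fin 3) L) := by
  rw [toPolynomial_apply]
  exact map_id _

/-- Evaluation of forms of degree `n` at a point of the chart where a form `F` of degree `n` does
not vanish, normalized by the value of `F`. -/
def evalForm {n : ℕ} {F : MvPolynomial (Fin 3) L} (hF : F ∈ homogeneousSubmodule (Fin 3) L n)
    (ψ : Away (homogeneousSubmodule (Fin 3) L) F →+* L) (p : MvPolynomial (Fin 3) L) : L :=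
  -- Projecting to degree n first makes this a function on all polynomials, additive without side
  -- conditions.
  ψ (Away.mk _ hF 1 (homogeneousComponent n p)
    (by rw [one_smul]; exact homogeneousComponent_mem _ _))

section EvalForm

variable {n : ℕ} {F : MvPolynomial (Fin 3) L} (hF : F ∈ homogeneousSubmodule (Fin 3) L n)
    (ψ : Away (homogeneousSubmodule (Fin 3) L) F →+* L)

lemma evalForm_of_isHomogeneous {p : MvPolynomial (Fin 3) L} (hp : p.IsHomogeneous n) :
    evalForm hF ψ p = ψ (Away.mk _ hF 1 p (by rw [one_smul]; exact hp)) := by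
  simp only [evalForm, homogeneousComponent_eq_self hp]

lemma evalForm_add (p q : MvPolynomial (Fin 3) L) :
    evalForm hF ψ (p + q) = evalForm hF ψ p + evalForm hF ψ q := by
  rw [evalForm, evalForm, evalForm, ← map_add]
  congr 1
  apply HomogeneousLocalization.val_injective
  simp [Away.val_mk, Localization.add_mk_self]

lemma evalForm_zero : evalForm hF ψ 0 = 0 := by
  simpa using evalForm_add hF ψ 0 0

lemma evalForm_smul (hψ : ∀ c, ψ (algebraMap L _ c) = c) (c : L) (p : MvPolynomial (Fin 3) L) :
    evalForm hF ψ (c • p) = c * evalForm hF ψ p := by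
  rw [evalForm, evalForm, ← hψ c, ← map_mul, ← Algebra.smul_def, hψ]
  congr 1
  apply HomogeneousLocalization.val_injective
  simp [Away.val_mk, Localization.smul_mk]

lemma evalForm_prod {p q : Fin 3 → MvPolynomial (Fin 3) L} (hp : ∀ i, (p i).IsHomogeneous n)
    (hq : ∀ i, (q i).IsHomogeneous n) (h : ∏ i, p i = ∏ i, q i) :
    ∏ i, evalForm hF ψ (p i) = ∏ i, evalForm hF ψ (q i) := by
  simp only [evalForm_of_isHomogeneous, hp, hq, ← map_prod]
  congr 1
  simp only [Fin.prod_univ_three] at h ⊢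
  apply HomogeneousLocalization.val_injective
  simp only [val_mul, Away.val_mk, Localization.mk_mul, h]

/-- F has value 1. If all Xᵢ^n had value 0, then so would every monomial of degree n, since it
contains some Xᵢ and its n-th power is therefore divisible by Xᵢ^n; then F would have value 0. -/
lemma exists_evalForm_X_pow_ne_zero (hn : 0 < n) (hψ : ∀ c, ψ (algebraMap L _ c) = c) :
    ∃ i, evalForm hF ψ (X i ^ n) ≠ 0 := by
  obtain ⟨k, rfl⟩ : ∃ k, n = k + 1 := ⟨n - 1, by omega⟩
  by_contra! h
  have h1 : evalForm hF ψ F = 1 := by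
    rw [evalForm_of_isHomogeneous hF ψ hF, ← map_one ψ]
    congr 1
    apply HomogeneousLocalization.val_injective
    rw [Away.val_mk, val_one, Localization.mk_eq_mk'_apply]
    simp
  have h2 (d : Fin 3 →₀ ℕ) (hd : d.degree = k + 1) : evalForm hF ψ (monomial d 1) = 0 := by
    have hd0 : d ≠ 0 := by rintro rfl; simp at hd
    obtain ⟨i, hi⟩ := Finsupp.ne_iff.mp hd0
    obtain ⟨d, rfl⟩ := exists_add_of_le
      (Finsupp.single_le_iff.mpr (Nat.one_le_iff_ne_zero.mpr hi) : Finsupp.single i 1 ≤ d)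
    have hν : monomial (Finsupp.single i 1 + d) (1 : L) = X i * monomial d 1 := by
      rw [X, monomial_mul, one_mul]
    have hνk : (monomial d (1 : L)).IsHomogeneous k := by
      refine isHomogeneous_monomial _ ?_
      rw [map_add, Finsupp.degree_single] at hd
      omega
    have hX : (X i ^ (k + 1) : MvPolynomial (Fin 3) L).IsHomogeneous (k + 1) :=
      isHomogeneous_X_pow i _
    have hmd := isHomogeneous_monomial (σ := Fin 3) (1 : L) hd
    refine pow_eq_zero_iff (n := k + 1) (by omega) |>.mp ?_
    rw [evalForm_of_isHomogeneous hF ψ hmd, ← map_pow]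
    have h3 : Away.mk _ hF 1 (monomial (Finsupp.single i 1 + d) 1) (by rw [one_smul]; exact hmd) ^ (k + 1) =
        Away.mk _ hF 1 (X i ^ (k + 1)) (by rw [one_smul]; exact hX) *
          Away.mk _ hF k (monomial d 1 ^ (k + 1))
            (by rw [smul_eq_mul]; exact hνk.pow _) := by
      apply HomogeneousLocalization.val_injective
      rw [val_mul, val_pow, Away.val_mk, Away.val_mk, Away.val_mk, Localization.mk_mul,
        Localization.mk_pow]
      congr 1
      · rw [hν, mul_pow]
      · refine Subtype.ext ?_
        simp [pow_succ, mul_comm]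
    rw [h3, map_mul, ← evalForm_of_isHomogeneous hF ψ hX, h, zero_mul]
  have h4 : evalForm hF ψ F = 0 := by
    let Φ : MvPolynomial (Fin 3) L →ₗ[L] L :=
      { toFun := evalForm hF ψ
        map_add' := evalForm_add hF ψ
        map_smul' := evalForm_smul hF ψ hψ }
    change Φ F = 0
    rw [F.as_sum, map_sum]
    refine Finset.sum_eq_zero fun d hd ↦ ?_
    have : monomial d (coeff d F) = coeff d F • monomial d (1 : L) := by
      rw [smul_monomial, smul_eq_mul, mul_one]
    rw [this, map_smul]
    change _ • evalForm hF ψ _ = 0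
    rw [h2 d (IsHomogeneous.degree_eq_sum_deg_support hF hd).symm, smul_zero]
  exact one_ne_zero (h1.symm.trans h4)

end EvalForm

lemma coef_ne_zero (i : Fin 3) : D.coef i ≠ 0 := by
  rw [coef]
  split_ifs
  exacts [D.algebraMap_a_ne_zero, one_ne_zero]

/-- A rational point of the twisted form shows that the constant `a` is a norm. -/
lemma exists_norm_eq_of_algHom (i : D.CoverIndex)
    (e : Away D.grading (D.coverElem i) →ₐ[K] K) :
    ∃ x, x * D.σ x * D.σ (D.σ x) = algebraMap K L D.a := by
  obtain ⟨ψ, hψ, hψe⟩ := D.exists_ringHom_away i e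
  obtain ⟨n, hn, hn0, h3⟩ : ∃ n, n = D.coverDegree i ∧ 0 < n ∧ 3 ∣ n :=
    ⟨_, rfl, D.coverDegree_pos i, dvd_mul_right _ _⟩
  have hf : D.coverElem i ∈ D.grading n := hn ▸ D.coverElem_mem i
  have hF := map_mem (D.toPolynomial (AlgHom.id K L)) hf
  let Ψ := evalForm hF ψ
  -- This is where rationality over K enters: on descended forms Ψ takes values in K, and both sides
  -- are σ-semilinear in p.
  have hΨ (p : MvPolynomial (Fin 3) L) (hp : p.IsHomogeneous n) :
      Ψ (D.twist p) = algebraMap K L D.a ^ (n / 3) * D.σ (Ψ p) := by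
    have hp' := D.mem_span_form h3 hp
    clear hp
    induction hp' using Submodule.span_induction with
    | zero => simp [Ψ, evalForm_zero]
    | add x y _ _ hx hy =>
      simp only [Ψ] at hx hy ⊢
      rw [map_add, evalForm_add, evalForm_add, hx, hy, map_add, mul_add]
    | smul c x _ hx =>
      simp only [Ψ] at hx ⊢
      rw [twist_smul, evalForm_smul hF ψ hψ, evalForm_smul hF ψ hψ, hx, map_mul]
      ring
    | mem x hx =>
      have h1 : Ψ x = algebraMap K L (e (Away.mk _ hf 1 ⟨x, D.form_le_ring n hx⟩
          (by rw [one_smul]; exact hx))) := by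
        rw [← hψe, Away.map_mk]
        simp only [Ψ, toPolynomial_id_apply]
        exact evalForm_of_isHomogeneous hF ψ hx.1
      rw [h1, AlgEquiv.commutes, ← h1, hx.2.2]
      exact evalForm_smul hF ψ hψ _ _
  have hX (k : Fin 3) : (X k ^ n : MvPolynomial (Fin 3) L).IsHomogeneous n :=
    isHomogeneous_X_pow _ _
  have hY (k : Fin 3) : (X (k + 1) * X k ^ (n - 1) : MvPolynomial (Fin 3) L).IsHomogeneous n := by
    have := (isHomogeneous_X L (k + 1)).mul (isHomogeneous_X_pow (R := L) k (n - 1))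
    rwa [Nat.add_sub_cancel' hn0] at this
  have hσX (k : Fin 3) : D.coef k ^ n * Ψ (X (k + 1) ^ n) =
      algebraMap K L D.a ^ (n / 3) * D.σ (Ψ (X k ^ n)) := by
    rw [← hΨ _ (hX k), map_pow, twist_X, mul_pow, ← C_pow, ← smul_eq_C_mul]
    exact (evalForm_smul hF ψ hψ _ _).symm
  have hσY (k : Fin 3) : D.coef (k + 1) * D.coef k ^ (n - 1) *
      Ψ (X (k + 1 + 1) * X (k + 1) ^ (n - 1)) =
      algebraMap K L D.a ^ (n / 3) * D.σ (Ψ (X (k + 1) * X k ^ (n - 1))) := by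
    rw [← hΨ _ (hY k), map_mul, map_pow, twist_X, twist_X, mul_pow, ← C_pow, mul_mul_mul_comm,
      ← C_mul, ← smul_eq_C_mul]
    exact (evalForm_smul hF ψ hψ _ _).symm
  have ha : algebraMap K L D.a ^ (n / 3) ≠ 0 := pow_ne_zero _ D.algebraMap_a_ne_zero
  -- The twist permutes the coordinates cyclically, so if one is nonzero then all are.
  have hstep (k : Fin 3) (hk : Ψ (X k ^ n) ≠ 0) : Ψ (X (k + 1) ^ n) ≠ 0 := fun h ↦ by
    have := hσX k
    rw [h, mul_zero, eq_comm, mul_eq_zero, map_eq_zero] at this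
    exact this.elim ha hk
  have hne : ∀ k, Ψ (X k ^ n) ≠ 0 := by
    obtain ⟨k, hk⟩ := exists_evalForm_X_pow_ne_zero hF ψ hn0 hψ
    have h1 := hstep _ hk
    have h2 := hstep _ h1
    fin_cases k
    · intro l; fin_cases l; exacts [hk, h1, h2]
    · intro l; fin_cases l; exacts [h2, hk, h1]
    · intro l; fin_cases l; exacts [h1, h2, hk]
  -- The ratio of coordinates x_{k+1} / x_k, expressed by forms of degree n. The product of the
  -- three ratios is 1, and σ takes each ratio to the next up to the coefficients of the twist.
  let l : Fin 3 → L := fun k ↦ Ψ (X (k + 1) * X k ^ (n - 1)) / Ψ (X k ^ n)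
  have hl (k : Fin 3) : D.σ (l k) = D.coef (k + 1) / D.coef k * l (k + 1) := by
    have h1 : D.coef k ^ n = D.coef k ^ (n - 1) * D.coef k := by
      rw [← pow_succ, Nat.sub_add_cancel hn0]
    have h2 := hσX k
    have h3 := hσY k
    have h4 := D.coef_ne_zero k
    have h5 : D.σ (Ψ (X k ^ n)) ≠ 0 := by simpa using hne k
    have h6 := hne (k + 1)
    rw [h1] at h2
    simp only [l, map_div₀]
    rw [div_mul_div_comm, div_eq_div_iff h5 (mul_ne_zero h4 h6)]
    apply mul_left_cancel₀ (mul_ne_zero ha (pow_ne_zero (n - 1) h4))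
    linear_combination (D.coef k ^ (n - 1) * D.coef k * Ψ (X (k + 1) ^ n)) * (-h3) +
      (D.coef (k + 1) * D.coef k ^ (n - 1) * Ψ (X (k + 1 + 1) * X (k + 1) ^ (n - 1))) * h2
  have hprod : ∏ k, l k = 1 := by
    simp only [l, Finset.prod_div_distrib]
    rw [div_eq_one_iff_eq (Finset.prod_ne_zero_iff.mpr fun k _ ↦ hne k)]
    refine evalForm_prod hF ψ hY hX ?_
    have h1 (k : Fin 3) : (X k : MvPolynomial (Fin 3) L) ^ n = X k * X k ^ (n - 1) := by
      rw [← pow_succ', Nat.sub_add_cancel hn0]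
    simp only [h1, Finset.prod_mul_distrib]
    congr 1
    simp only [Fin.prod_univ_three]
    change X 1 * X 2 * X 0 = X 0 * X 1 * X 2
    ring
  -- Here σ (l 0) = l 1 and σ (l 1) = a · l 2, so the norm of l 0 is a · l 0 · l 1 · l 2 = a.
  refine ⟨l 0, ?_⟩
  have e0 := hl 0
  have e1 := hl 1
  simp only [coef, Fin.isValue, zero_add, Fin.reduceAdd, Fin.reduceEq, if_false, if_true, div_one,
    one_mul] at e0 e1
  rw [Fin.prod_univ_three] at hprod
  rw [e0, e1]
  linear_combination algebraMap K L D.a * hprod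

lemma isNontrivialSeveriBrauerSurface [Algebra.IsAlgebraic K L]
    (ha : ∀ x, x * D.σ x * D.σ (D.σ x) ≠ algebraMap K L D.a) :
    IsNontrivialSeveriBrauerSurface K D.severiBrauer := by
  refine ⟨D.isSeveriBrauerSurface, ⟨fun φ ↦ ?_⟩⟩
  obtain ⟨s, hs⟩ := exists_section_projectivePlane K
  obtain ⟨i, ⟨e⟩⟩ := exists_algHom_of_section (𝒜 := D.grading) (s ≫ φ.inv.left)
    ((Category.assoc _ _ _).trans ((congr(s ≫ $(Over.w φ.inv))).trans hs)) D.coverElem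
    D.coverDegree D.coverElem_mem D.coverDegree_pos D.exists_mem_basicOpen_coverElem
  obtain ⟨x, hx⟩ := D.exists_norm_eq_of_algHom i e
  exact ha x hx

end CubicDatum

/-! ### The action of the semidirect product on the twisted plane. -/

namespace CubicDatum

open MvPolynomial

variable {K L : Type} [Field K] [Field L] [Algebra K L] (D : CubicDatum K L)
  {N H : Type} [Group N] [Group H] {φ : H →* MulAut N} (θ : H →* (L ≃ₐ[K] L)) (χ : N →* L)

/-- The conjugates of a character. -/
def conjChar (i : Fin 3) (n : N) : L := (D.σ ^ (i : ℕ)) (χ n)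

lemma σ_conjChar (i : Fin 3) (n : N) : D.σ (D.conjChar χ i n) = D.conjChar χ (i + 1) n := by
  fin_cases i
  · rfl
  · rfl
  · exact D.σ_pow_three _

lemma conjChar_mul (i : Fin 3) (m n : N) :
    D.conjChar χ i (m * n) = D.conjChar χ i m * D.conjChar χ i n := by
  simp [conjChar]

lemma conjChar_one (i : Fin 3) : D.conjChar χ i (1 : N) = 1 := by simp [conjChar]

/-- The action of a semidirect product on the polynomial ring: the normal factor acts by diagonal
matrices, and the complement acts on the coefficients. -/
def polyAction (g : N ⋊[φ] H) : MvPolynomial (Fin 3) L →ₐ[K] MvPolynomial (Fin 3) L where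
  __ := eval₂Hom (C.comp (θ g.right : L →+* L)) fun i ↦ C (D.conjChar χ i g.left) * X i
  commutes' c := by
    change eval₂Hom _ _ (C (algebraMap K L c)) = C (algebraMap K L c)
    simp

lemma polyAction_C (g : N ⋊[φ] H) (c : L) : D.polyAction θ χ g (C c) = C (θ g.right c) := by
  change eval₂Hom _ _ (C c) = _
  simp

lemma polyAction_X (g : N ⋊[φ] H) (i : Fin 3) :
    D.polyAction θ χ g (X i) = C (D.conjChar χ i g.left) * X i := by
  change eval₂Hom _ _ (X i) = _
  simp

lemma polyAction_one : D.polyAction θ χ (1 : N ⋊[φ] H) = AlgHom.id K _ := by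
  refine AlgHom.coe_ringHom_injective (ringHom_ext (fun c ↦ ?_) fun i ↦ ?_)
  · change D.polyAction θ χ 1 (C c) = C c
    rw [polyAction_C, SemidirectProduct.one_right, map_one, AlgEquiv.one_apply]
  · change D.polyAction θ χ 1 (X i) = X i
    rw [polyAction_X, SemidirectProduct.one_left, conjChar_one, C_1, one_mul]

variable (hσθ : ∀ h c, D.σ (θ h c) = θ h (D.σ c))

include hσθ in
lemma θ_conjChar (hχ : ∀ h n, θ h (χ n) = χ (φ h n)) (i : Fin 3) (h : H) (n : N) :
    θ h (D.conjChar χ i n) = D.conjChar χ i (φ h n) := by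
  have h1 (k : ℕ) (c : L) : θ h ((D.σ ^ k) c) = (D.σ ^ k) (θ h c) := by
    induction k with
    | zero => rfl
    | succ k ih => rw [pow_succ', AlgEquiv.mul_apply, AlgEquiv.mul_apply, ← hσθ, ih]
  rw [conjChar, h1, hχ, conjChar]

include hσθ in
lemma polyAction_mul (hχ : ∀ h n, θ h (χ n) = χ (φ h n)) (g h : N ⋊[φ] H) :
    D.polyAction θ χ (g * h) = (D.polyAction θ χ g).comp (D.polyAction θ χ h) := by
  refine AlgHom.coe_ringHom_injective (ringHom_ext (fun c ↦ ?_) fun i ↦ ?_)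
  · change D.polyAction θ χ (g * h) (C c) = D.polyAction θ χ g (D.polyAction θ χ h (C c))
    rw [polyAction_C, polyAction_C, polyAction_C, SemidirectProduct.mul_right, map_mul,
      AlgEquiv.mul_apply]
  · change D.polyAction θ χ (g * h) (X i) = D.polyAction θ χ g (D.polyAction θ χ h (X i))
    rw [polyAction_X, polyAction_X, map_mul, polyAction_C, polyAction_X,
      SemidirectProduct.mul_left, conjChar_mul, D.θ_conjChar θ χ hσθ hχ, C_mul]
    ring

-- On coefficients, θ commutes with σ; on variables, applying σ to the i-th conjugate of χ gives the
-- (i+1)-st, which matches the shift Xᵢ ↦ Xᵢ₊₁. The constant a lies in K and is fixed by θ.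
include hσθ in
lemma twist_polyAction (g : N ⋊[φ] H) (p : MvPolynomial (Fin 3) L) :
    D.twist (D.polyAction θ χ g p) = D.polyAction θ χ g (D.twist p) := by
  have : D.twist.comp (D.polyAction θ χ g : _ →+* MvPolynomial (Fin 3) L) =
      (D.polyAction θ χ g : _ →+* MvPolynomial (Fin 3) L).comp D.twist := by
    refine ringHom_ext (fun c ↦ ?_) fun i ↦ ?_
    · change D.twist (D.polyAction θ χ g (C c)) = D.polyAction θ χ g (D.twist (C c))
      rw [polyAction_C, twist_C, twist_C, polyAction_C, hσθ]
    · change D.twist (D.polyAction θ χ g (X i)) = D.polyAction θ χ g (D.twist (X i))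
      have h1 : θ g.right (D.coef i) = D.coef i := by
        rw [coef]; split_ifs <;> simp
      rw [polyAction_X, map_mul, twist_C, twist_X, map_mul, polyAction_C, polyAction_X, h1,
        σ_conjChar]
      ring
  exact congr($this p)

include hσθ in
lemma polyAction_mem_form (g : N ⋊[φ] H) {n : ℕ} {p : MvPolynomial (Fin 3) L}
    (hp : p ∈ D.form n) : D.polyAction θ χ g p ∈ D.form n := by
  refine ⟨?_, fun h ↦ by rw [hp.2.1 h, map_zero], ?_⟩
  · rw [← one_mul n]
    exact hp.1.eval₂ _ _ (fun c ↦ isHomogeneous_C _ _) fun i ↦ isHomogeneous_C_mul_X _ _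
  · rw [D.twist_polyAction θ χ hσθ, hp.2.2, smul_eq_C_mul, map_mul, polyAction_C,
      smul_eq_C_mul]
    simp

include hσθ in
lemma polyAction_mem_ring (g : N ⋊[φ] H) {p : MvPolynomial (Fin 3) L}
    (hp : p ∈ D.ring) : D.polyAction θ χ g p ∈ D.ring := by
  induction hp using Submodule.iSup_induction' with
  | zero => rw [map_zero]; exact zero_mem _
  | add x y _ _ hx hy => rw [map_add]; exact add_mem hx hy
  | mem m p hp => exact D.form_le_ring m (D.polyAction_mem_form θ χ hσθ g hp)

variable (hχ : ∀ h n, θ h (χ n) = χ (φ h n))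

/-- The action of a semidirect product on the coordinate ring of the twisted form. -/
def ringAction : N ⋊[φ] H →* (D.ring ≃ₐ[K] D.ring) :=
  (AlgEquiv.algHomUnitsEquiv K D.ring).toMonoidHom.comp <| MonoidHom.toHomUnits
    { toFun := fun g ↦ ((D.polyAction θ χ g).comp D.ring.val).codRestrict D.ring
        fun p ↦ D.polyAction_mem_ring θ χ hσθ g p.2
      map_one' := by
        refine AlgHom.ext fun p ↦ Subtype.ext ?_
        exact congr($(D.polyAction_one θ χ) (p : MvPolynomial (Fin 3) L))
      map_mul' := fun g h ↦ by
        refine AlgHom.ext fun p ↦ Subtype.ext ?_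
        exact congr($(D.polyAction_mul θ χ hσθ hχ g h) (p : MvPolynomial (Fin 3) L)) }

lemma coe_ringAction (g : N ⋊[φ] H) (p : D.ring) :
    (D.ringAction θ χ hσθ hχ g p : MvPolynomial (Fin 3) L) = D.polyAction θ χ g p := rfl

/-- The action of a semidirect product on the twisted form of the projective plane. -/
def severiBrauerAction : N ⋊[φ] H →* Aut D.severiBrauer :=
  projAction (D.ringAction θ χ hσθ hχ) fun g _ _ hp ↦ D.polyAction_mem_form θ χ hσθ g hp

/-- The norm condition makes X₀X₁X₂ a fixed descended cubic, so a trivial action on the surface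
fixes every descended cubic, and by L-linearity every cubic. The cube X₀³ gives the conclusion. -/
lemma char_pow_three_eq_one (hN : ∀ n, χ n * D.σ (χ n) * D.σ (D.σ (χ n)) = 1) {n : N}
    (hn : D.severiBrauerAction θ χ hσθ hχ (SemidirectProduct.inl n) = 1) : χ n ^ 3 = 1 := by
  have hf : (X 0 * X 1 * X 2 : MvPolynomial (Fin 3) L) ∈ D.form 3 := by
    refine ⟨((isHomogeneous_X L 0).mul (isHomogeneous_X L 1)).mul (isHomogeneous_X L 2),
      fun h ↦ absurd (dvd_refl 3) h, ?_⟩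
    simp only [map_mul, twist_X, coef, smul_eq_C_mul]
    simp
    ring
  have h1 : ∀ p ∈ D.form 3, D.polyAction θ χ (SemidirectProduct.inl n : N ⋊[φ] H) p = p := by
    intro p hp
    have h2 := eq_of_projAction_eq_one _ _ hn (m := 3) (by norm_num)
      (f := ⟨_, D.form_le_ring 3 hf⟩) (fun h ↦ ?_) hf ?_
      (x := ⟨p, D.form_le_ring 3 hp⟩) hp
    · exact congr(($h2 : MvPolynomial (Fin 3) L))
    · have h3 : (X 0 * X 1 * X 2 : MvPolynomial (Fin 3) L) = 0 := congrArg Subtype.val h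
      simp at h3
    · apply Subtype.ext
      rw [coe_ringAction]
      simp only [map_mul, polyAction_X, SemidirectProduct.left_inl]
      have h4 : (C (D.conjChar χ 0 n * D.conjChar χ 1 n * D.conjChar χ 2 n) :
          MvPolynomial (Fin 3) L) = 1 := by
        rw [← C_1]
        exact congr(C $(hN n))
      rw [C_mul, C_mul] at h4
      linear_combination (X 0 * X 1 * X 2 : MvPolynomial (Fin 3) L) * h4
  have h2 : ∀ p ∈ Submodule.span L (D.form 3 : Set (MvPolynomial (Fin 3) L)),
      D.polyAction θ χ (SemidirectProduct.inl n : N ⋊[φ] H) p = p := by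
    intro p hp
    induction hp using Submodule.span_induction with
    | zero => rw [map_zero]
    | add x y _ _ hx hy => rw [map_add, hx, hy]
    | smul c x _ hx =>
      rw [smul_eq_C_mul, map_mul, hx, polyAction_C, SemidirectProduct.right_inl, map_one,
        AlgEquiv.one_apply]
    | mem x hx => exact h1 x hx
  have h3 := h2 _ (D.mem_span_form (dvd_refl 3) (isHomogeneous_X_pow 0 3))
  rw [map_pow, polyAction_X, mul_pow, ← C_pow, ← smul_eq_C_mul] at h3
  have h4 := congr(coeff (Finsupp.single 0 3) $h3)
  rw [coeff_smul, coeff_X_pow] at h4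
  simpa [conjChar] using h4

end CubicDatum

/-- A homomorphism from a semidirect product by a faithful action on an abelian group is injective
if it is injective on the normal factor. -/
lemma SemidirectProduct.injective_of_injective_inl {N H Γ : Type} [CommGroup N] [Group H] [Group Γ]
    {φ : H →* MulAut N} (hφ : Function.Injective φ) (f : N ⋊[φ] H →* Γ)
    (hf : ∀ n, f (SemidirectProduct.inl n) = 1 → n = 1) : Function.Injective f := by
  rw [injective_iff_map_eq_one]
  intro g hg
  have hr : g.right = 1 := by
    apply hφ
    ext m
    rw [map_one, MulAut.one_apply]
    have h1 : g * inl m * g⁻¹ = inl (φ g.right m) := by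
      ext <;> simp
    -- A commutator with an element of the kernel is in the kernel, and this one lies in the normal
    -- factor.
    have h2 : f (inl (φ g.right m * m⁻¹)) = 1 := by
      rw [map_mul, ← h1]
      simp [hg]
    exact mul_inv_eq_one.mp (hf _ h2)
  have h3 : g = inl g.left := by ext <;> simp [hr]
  rw [h3] at hg ⊢
  rw [hf _ hg, map_one]

/-! ### Inert primes are not norms. -/

section Inert

open NumberField

/-- A rational prime that is a primitive root modulo `p` stays prime in the `p`-th cyclotomic
field. -/
lemma IsCyclotomicExtension.Rat.prime_natCast {p q : ℕ} [hp : Fact p.Prime] [hq : Fact q.Prime]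
    (L : Type) [Field L] [NumberField L] [IsCyclotomicExtension {p} ℚ L]
    (h : orderOf (q : ZMod p) = p - 1) (hpq : ¬ q ∣ p) : Prime (q : 𝓞 L) := by
  have hq0 : (q : 𝓞 L) ≠ 0 := Nat.cast_ne_zero.mpr hq.out.ne_zero
  have hmax : (Ideal.span {(q : ℤ)}).IsMaximal :=
    Int.ideal_span_isMaximal_of_prime q
  obtain ⟨P, hP1, hP2⟩ := Ideal.exists_maximal_ideal_liesOver_of_isIntegral
    (Ideal.span {(q : ℤ)}) (S := 𝓞 L)
  have hf : P.inertiaDeg ℤ = p - 1 := by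
    rw [inertiaDeg_eq_of_not_dvd q L P (m := p) hpq, h]
  have hN : Ideal.absNorm P = q ^ (p - 1) := by
    rw [Ideal.absNorm_eq_pow_inertiaDeg' P hq.out, Ideal.inertiaDeg'_eq_inertiaDeg, hf]
  have hd : Module.finrank ℤ (𝓞 L) = p - 1 := by
    rw [RingOfIntegers.rank, IsCyclotomicExtension.finrank L
      (Polynomial.cyclotomic.irreducible_rat hp.out.pos), Nat.totient_prime hp.out]
  have hmem : (q : 𝓞 L) ∈ P := by
    have := (Ideal.mem_of_liesOver P (Ideal.span {(q : ℤ)}) (q : ℤ)).mp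
      (Ideal.mem_span_singleton_self _)
    simpa using this
  -- The residue degree p - 1 is the full degree of the field, so P and (q) have the same norm and
  -- the cofactor J is trivial.
  obtain ⟨J, hJ⟩ := Ideal.dvd_iff_le.mpr ((Ideal.span_singleton_le_iff_mem P).mpr hmem)
  have h1 := congr(Ideal.absNorm $hJ)
  rw [map_mul, hN, Ideal.absNorm_span_natCast, hd] at h1
  have h2 : Ideal.absNorm J = 1 := by
    have : q ^ (p - 1) ≠ 0 := pow_ne_zero _ hq.out.ne_zero
    exact Nat.eq_of_mul_eq_mul_left (Nat.pos_of_ne_zero this) (by rw [← h1, mul_one])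
  rw [Ideal.absNorm_eq_one_iff.mp h2, Ideal.mul_top] at hJ
  rw [← Ideal.span_singleton_prime hq0, hJ]
  exact hP1.isPrime

/-- An element that stays prime is not a norm from a cyclic cubic extension. -/
lemma NumberField.mul_mul_ne_natCast {L : Type} [Field L] [NumberField L] {q : ℕ}
    (hq : Prime (q : 𝓞 L)) (σ : L ≃+* L) (x : L) : x * σ x * σ (σ x) ≠ q := by
  intro hx
  obtain ⟨u, w, hw, rfl⟩ := IsFractionRing.div_surjective (A := 𝓞 L) x
  have hw0 : w ≠ 0 := nonZeroDivisors.ne_zero hw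
  let s := RingOfIntegers.mapRingEquiv σ
  have hs (y : 𝓞 L) : σ (algebraMap _ L y) = algebraMap _ L (s y) := rfl
  have h0 {y : 𝓞 L} (hy : y ≠ 0) : algebraMap _ L y ≠ 0 := by simpa using hy
  have hs0 {y : 𝓞 L} (hy : y ≠ 0) : s y ≠ 0 := by simpa using hy
  have h1 : u * s u * s (s u) = q * (w * s w * s (s w)) := by
    apply FaithfulSMul.algebraMap_injective (𝓞 L) L
    simp only [map_div₀, hs] at hx
    have h2 := h0 hw0
    have h3 := h0 (hs0 hw0)
    have h4 := h0 (hs0 (hs0 hw0))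
    field_simp at hx
    simp only [map_mul, map_natCast]
    linear_combination hx
  have hu0 : u ≠ 0 := by
    rintro rfl
    simp only [map_zero, mul_zero] at h1
    exact mul_ne_zero hq.ne_zero (mul_ne_zero (mul_ne_zero hw0 (hs0 hw0)) (hs0 (hs0 hw0))) h1.symm
  -- As q is fixed by the automorphism, its valuation is invariant. The equation then reads 3 v(u) =
  -- 1 + 3 v(w), impossible mod 3.
  have hsm (y : 𝓞 L) : emultiplicity (q : 𝓞 L) (s y) = emultiplicity (q : 𝓞 L) y := by
    simpa only [map_natCast] using emultiplicity_map_eq s (a := (q : 𝓞 L)) (b := y)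
  have h2 := congr(emultiplicity (q : 𝓞 L) $h1)
  simp only [emultiplicity_mul hq, hsm,
    (FiniteMultiplicity.of_prime_left hq hq.ne_zero).emultiplicity_self,
    (FiniteMultiplicity.of_prime_left hq hu0).emultiplicity_eq_multiplicity,
    (FiniteMultiplicity.of_prime_left hq hw0).emultiplicity_eq_multiplicity] at h2
  norm_cast at h2
  omega

/-- There is a rational prime that is a primitive root modulo a given prime `p`. -/
lemma Nat.exists_prime_orderOf_eq (p : ℕ) [hp : Fact p.Prime] :
    ∃ q : ℕ, q.Prime ∧ orderOf (q : ZMod p) = p - 1 ∧ ¬ q ∣ p := by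
  obtain ⟨g, hg⟩ := IsCyclic.exists_ofOrder_eq_natCard (α := (ZMod p)ˣ)
  -- Dirichlet's theorem; asking for q > p excludes q ∣ p.
  obtain ⟨q, hqp, hq, hqg⟩ := Nat.forall_exists_prime_gt_and_eq_mod g.isUnit p
  refine ⟨q, hq, ?_, fun h ↦ absurd (Nat.le_of_dvd hp.out.pos h) (by omega)⟩
  rw [hqg, orderOf_units, hg, Nat.card_eq_fintype_card, ZMod.card_units]

end Inert

/-! ### Normal abelian subgroups of the semidirect product. -/

section Metacyclic

/-- A non-trivial homomorphism from a group of prime order is injective. -/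
lemma MonoidHom.injective_of_prime_card {G Γ : Type} [Group G] [Group Γ] {r : ℕ} [Fact r.Prime]
    (h : Nat.card G = r) {f : G →* Γ} (hf : f ≠ 1) : Function.Injective f := by
  rw [injective_iff_map_eq_one]
  intro g hg
  by_contra hg1
  refine hf (MonoidHom.ext fun x ↦ ?_)
  obtain ⟨n, rfl⟩ := mem_powers_of_prime_card h hg1 (g' := x)
  rw [map_pow, hg, one_pow, MonoidHom.one_apply]

/-- The normal abelian subgroups of a non-trivial semidirect product of a group of order three and a
group of odd order have index at least three. -/
lemma SemidirectProduct.isLeast_index {N H : Type} [CommGroup N] [Group H] [Finite N]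
    (φ : H →* MulAut N) (hφ : φ ≠ 1) (hH : Nat.card H = 3) (hN : Odd (Nat.card N)) :
    IsLeast {n : ℕ | ∃ A : Subgroup (N ⋊[φ] H),
      A.Normal ∧ (∀ x ∈ A, ∀ y ∈ A, x * y = y * x) ∧ A.index = n} 3 := by
  have hfin : Finite H := Nat.finite_of_card_ne_zero (by omega)
  have hfin' : Finite (N ⋊[φ] H) := Finite.of_equiv _ SemidirectProduct.equivProd.symm
  constructor
  · refine ⟨(rightHom : N ⋊[φ] H →* H).ker, inferInstance, fun x hx y hy ↦ ?_, ?_⟩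
    · have hx' : x.right = 1 := hx
      have hy' : y.right = 1 := hy
      ext
      · simp [hx', hy', mul_comm]
      · simp [hx', hy']
    · rw [Subgroup.index_ker, MonoidHom.range_eq_top.mpr rightHom_surjective, Subgroup.card_top, hH]
  · rintro n ⟨A, -, hA, rfl⟩
    by_contra! hlt
    have h0 : A.index ≠ 0 := Subgroup.index_ne_zero_of_finite
    have h1 : A.index ≠ 1 := by
      rw [ne_eq, Subgroup.index_eq_one]
      rintro rfl
      refine hφ (MonoidHom.ext fun h ↦ MulEquiv.ext fun n ↦ ?_)
      have := congr(SemidirectProduct.left $(hA (inr h) trivial (inl n) trivial))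
      simpa using this
    -- Index 1 is excluded by non-commutativity, and index 2 because the group has odd order.
    have h2 : A.index ∣ Nat.card N * 3 := hH ▸ SemidirectProduct.card (φ := φ) ▸ A.index_dvd_card
    have h3 : A.index = 2 := by omega
    rw [h3] at h2
    obtain ⟨m, hm⟩ := hN
    omega

end Metacyclic

/-! ### The cyclotomic field and the final construction. -/

section

variable {p : ℕ} [hp : Fact p.Prime]

/-- The multiplier of an automorphism of the cyclic group of order `p`. -/
def ZMod.multiplier : MulAut (Multiplicative (ZMod p)) →* (ZMod p)ˣ :=
  MonoidHom.toHomUnits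
    { toFun := fun f ↦ (f (.ofAdd 1)).toAdd
      map_one' := rfl
      map_mul' := fun f g ↦ by
        have h (n : ZMod p) : (f (.ofAdd n)).toAdd = (f (.ofAdd 1)).toAdd * n := by
          have : Multiplicative.ofAdd n = Multiplicative.ofAdd 1 ^ n.val := by
            rw [← ofAdd_nsmul, nsmul_one, ZMod.natCast_zmod_val]
          rw [this, map_pow, toAdd_pow, nsmul_eq_mul, ZMod.natCast_zmod_val, mul_comm]
        exact h _ }

lemma ZMod.apply_eq_multiplier_mul (f : MulAut (Multiplicative (ZMod p)))
    (n : Multiplicative (ZMod p)) :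
    f n = .ofAdd ((ZMod.multiplier f : ZMod p) * n.toAdd) := by
  have : n = Multiplicative.ofAdd 1 ^ n.toAdd.val := by
    rw [← ofAdd_nsmul, nsmul_one, ZMod.natCast_zmod_val, ofAdd_toAdd]
  conv_lhs => rw [this, map_pow]
  apply Multiplicative.toAdd.injective
  rw [toAdd_pow, nsmul_eq_mul, ZMod.natCast_zmod_val, mul_comm]
  rfl

lemma ZMod.multiplier_injective : Function.Injective (ZMod.multiplier (p := p)) :=
  fun f g h ↦ MulEquiv.ext fun n ↦ by
    rw [apply_eq_multiplier_mul f, apply_eq_multiplier_mul g, h]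

/-- The character of the cyclic group of order `p` defined by a root of unity. -/
def ZMod.powChar {L : Type} [Field L] {ζ : L} (hζ : ζ ^ p = 1) : Multiplicative (ZMod p) →* L where
  toFun n := ζ ^ n.toAdd.val
  map_one' := by simp
  map_mul' m n := by
    rw [toAdd_mul, ZMod.val_add, ← pow_add, ← pow_eq_pow_mod _ hζ]

variable (φ : Multiplicative (ZMod 3) →* MulAut (Multiplicative (ZMod p)))
  (L : Type) [Field L] [NumberField L] [IsCyclotomicExtension {p} ℚ L]

/-- A homomorphism from the cyclic group of order three to the automorphisms of the cyclic group of
prime order `p`, seen as an action on the `p`-th cyclotomic field. -/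
def cyclotomicAction :
    Multiplicative (ZMod 3) →* Gal(L/ℚ) :=
  (IsCyclotomicExtension.Rat.galEquivZMod p L).symm.toMonoidHom.comp
    (ZMod.multiplier.comp φ)

variable {φ} in
lemma cyclotomicAction_injective (hφ : Function.Injective φ) : Function.Injective (cyclotomicAction φ L) :=
  (IsCyclotomicExtension.Rat.galEquivZMod p L).symm.injective.comp
    (ZMod.multiplier_injective.comp hφ)

/-- Galois acts on roots of unity by the exponent by which φ acts on the cyclic group. This
equivariance is what makes the diagonal and Galois actions assemble into an action of the semidirect
product. -/
lemma cyclotomicAction_powChar {ζ : L} (hζ : ζ ^ p = 1) (h : Multiplicative (ZMod 3))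
    (n : Multiplicative (ZMod p)) :
    cyclotomicAction φ L h (ZMod.powChar hζ n) = ZMod.powChar hζ (φ h n) := by
  change cyclotomicAction φ L h (ζ ^ n.toAdd.val) = ζ ^ (φ h n).toAdd.val
  have h1 : IsCyclotomicExtension.Rat.galEquivZMod p L (cyclotomicAction φ L h) =
      ZMod.multiplier (φ h) := MulEquiv.apply_symm_apply _ _
  rw [map_pow, IsCyclotomicExtension.Rat.galEquivZMod_apply_of_pow_eq p _ _ hζ, ← pow_mul,
    h1, ZMod.apply_eq_multiplier_mul (φ h) n, toAdd_ofAdd, ZMod.val_mul,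
    ← pow_eq_pow_mod _ hζ]

/-- The fixed field of the action on the cyclotomic field. -/
abbrev cyclotomicFixedField : IntermediateField ℚ L :=
  IntermediateField.fixedField (cyclotomicAction φ L).range

/-- The action on the cyclotomic field, over its fixed field. -/
def cyclotomicRelAction :
    Multiplicative (ZMod 3) →* Gal(L/(cyclotomicFixedField φ L)) :=
  (IntermediateField.fixingSubgroupEquiv (cyclotomicFixedField φ L)).toMonoidHom.comp <|
    (cyclotomicAction φ L).codRestrict _ fun h x ↦
      (IntermediateField.mem_fixedField_iff _ _).mp x.2 _ ⟨h, rfl⟩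

lemma cyclotomicRelAction_commute (g h : Multiplicative (ZMod 3)) (x : L) :
    cyclotomicRelAction φ L g (cyclotomicRelAction φ L h x) =
      cyclotomicRelAction φ L h (cyclotomicRelAction φ L g x) := by
  rw [← AlgEquiv.mul_apply, ← AlgEquiv.mul_apply, ← map_mul, ← map_mul, mul_comm]

/-- The datum of a cyclic algebra over the fixed field of the action on the cyclotomic field,
attached to a rational number. -/
def cyclotomicDatum (hφ : Function.Injective φ) {a : ℕ} (ha : a ≠ 0) :
    CubicDatum (cyclotomicFixedField φ L) L where
  σ := cyclotomicRelAction φ L (.ofAdd 1)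
  σ_pow_three x := by
    rw [← AlgEquiv.mul_apply, ← AlgEquiv.mul_apply, ← map_mul, ← map_mul]
    have : (Multiplicative.ofAdd 1 * Multiplicative.ofAdd 1 * Multiplicative.ofAdd 1 :
      Multiplicative (ZMod 3)) = 1 := by decide
    rw [this, map_one, AlgEquiv.one_apply]
  σ_nontrivial := by
    by_contra! h
    have h1 : cyclotomicAction φ L (.ofAdd 1) = cyclotomicAction φ L 1 := by
      rw [map_one (cyclotomicAction φ L)]
      exact AlgEquiv.ext fun x ↦ h x
    exact absurd (cyclotomicAction_injective L hφ h1) (by decide)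
  fixed x hx := by
    refine ⟨⟨x, (IntermediateField.mem_fixedField_iff _ _).mpr ?_⟩, rfl⟩
    rintro _ ⟨h, rfl⟩
    change cyclotomicRelAction φ L h x = x
    have h1 : h = Multiplicative.ofAdd 1 ^ h.toAdd.val := by
      rw [← ofAdd_nsmul, nsmul_one, ZMod.natCast_zmod_val, ofAdd_toAdd]
    rw [h1]
    generalize h.toAdd.val = n
    induction n with
    | zero => rw [pow_zero, map_one, AlgEquiv.one_apply]
    | succ n ih => rw [pow_succ, map_mul, AlgEquiv.mul_apply, hx, ih]
  a := a
  a_ne_zero := Nat.cast_ne_zero.mpr ha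

/-- The orbit of an element under a non-trivial automorphism of order three of a cyclic group of
prime order has trivial product. -/
lemma orbit_mul_eq_one (hφ : Function.Injective φ) (n : Multiplicative (ZMod p)) :
    n * φ (.ofAdd 1) n * φ (.ofAdd 1) (φ (.ofAdd 1) n) = 1 := by
  set r : (ZMod p)ˣ := ZMod.multiplier (φ (.ofAdd 1)) with hr
  have h1 : r ^ 3 = 1 := by
    rw [hr, ← map_pow, ← map_pow]
    have : (Multiplicative.ofAdd 1 : Multiplicative (ZMod 3)) ^ 3 = 1 := by decide
    rw [this, map_one, map_one]
  have h2 : (r : ZMod p) - 1 ≠ 0 := by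
    rw [sub_ne_zero, ne_eq, Units.val_eq_one, hr, ← map_one (ZMod.multiplier (p := p)),
      ZMod.multiplier_injective.eq_iff, ← map_one φ, hφ.eq_iff]
    decide
  -- The multiplier r is a nontrivial cube root of unity in a field, so the factor r - 1 of r³ - 1
  -- can be cancelled.
  have h3 : (1 + r + r ^ 2 : ZMod p) = 0 := by
    refine (mul_eq_zero.mp ?_).resolve_left h2
    have h4 : (r : ZMod p) ^ 3 = 1 := by rw [← Units.val_pow_eq_pow_val, h1, Units.val_one]
    linear_combination h4
  simp only [ZMod.apply_eq_multiplier_mul, ← hr, toAdd_ofAdd]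
  apply Multiplicative.toAdd.injective
  simp only [toAdd_mul, toAdd_ofAdd, toAdd_one]
  linear_combination n.toAdd * h3

include L in
/-- A non-trivial Severi–Brauer surface with a faithful action of a given non-commutative group
of order `3p`. -/
lemma exists_isNontrivialSeveriBrauerSurface (hp3 : p ≠ 3) (hφ : φ ≠ 1) :
    ∃ (K : Type) (_ : Field K) (_ : NumberField K) (S : Over (Spec (CommRingCat.of K))),
      IsNontrivialSeveriBrauerSurface K S ∧
        ∃ f : CyclicSemidirect p φ →* Aut S, Function.Injective f := by
  have hinj : Function.Injective φ := MonoidHom.injective_of_prime_card (r := 3) (by simp) hφ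
  obtain ⟨q, hq, hord, hqp⟩ := Nat.exists_prime_orderOf_eq p
  have : Fact q.Prime := ⟨hq⟩
  -- The constant of the cyclic algebra is the inert prime q.
  let D := cyclotomicDatum φ L hinj hq.ne_zero
  have hζ := IsCyclotomicExtension.zeta_spec p ℚ L
  have hχ := cyclotomicAction_powChar φ L hζ.pow_eq_one
  refine ⟨cyclotomicFixedField φ L, inferInstance, inferInstance, D.severiBrauer,
    D.isNontrivialSeveriBrauerSurface fun x ↦ ?_,
    D.severiBrauerAction (cyclotomicRelAction φ L) (ZMod.powChar hζ.pow_eq_one)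
      (fun h c ↦ cyclotomicRelAction_commute φ L _ h c) hχ, ?_⟩
  · have := NumberField.mul_mul_ne_natCast
      (IsCyclotomicExtension.Rat.prime_natCast (p := p) L hord hqp)
      (cyclotomicRelAction φ L (.ofAdd 1)).toRingEquiv x
    exact this
  · refine SemidirectProduct.injective_of_injective_inl hinj _ fun n hn ↦ ?_
    have h1 := D.char_pow_three_eq_one _ _ _ _ (fun m ↦ ?_) hn
    · change (_ ^ n.toAdd.val) ^ 3 = (1 : L) at h1
      -- The cube of a power of ζ is 1 only if p divides three times the exponent; as p ≠ 3, it
      -- divides the exponent, which is less than p.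
      rw [← pow_mul, hζ.pow_eq_one_iff_dvd, hp.out.dvd_mul,
        Nat.prime_dvd_prime_iff_eq hp.out Nat.prime_three] at h1
      rw [← ofAdd_toAdd n, (ZMod.val_eq_zero _).mp (Nat.eq_zero_of_dvd_of_lt
        (h1.resolve_right hp3) (ZMod.val_lt _)), ofAdd_zero]
    · change _ * cyclotomicAction φ L _ _ * cyclotomicAction φ L _ (cyclotomicAction φ L _ _) = _
      rw [hχ, hχ, ← map_mul, ← map_mul, orbit_mul_eq_one φ hinj, map_one]

end

end

theorem theorem2 (p k : ℕ) (hp : p.Prime) (hpk : p = 3 * k + 1)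
    (φ : Multiplicative (ZMod 3) →* MulAut (Multiplicative (ZMod p))) (hφ : φ ≠ 1) :
    (∃ (K : Type) (_ : Field K) (_ : NumberField K) (S : Over (Spec (CommRingCat.of K))),
      IsNontrivialSeveriBrauerSurface K S ∧
        ∃ f : CyclicSemidirect p φ →* Aut S, Function.Injective f) ∧
    IsLeast {n : ℕ | ∃ N : Subgroup (CyclicSemidirect p φ),
      N.Normal ∧ (∀ x ∈ N, ∀ y ∈ N, x * y = y * x) ∧ N.index = n} 3 := by
  have : Fact p.Prime := ⟨hp⟩
  have : IsCyclotomicExtension {p} ℚ (CyclotomicField p ℚ) := by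
    convert CyclotomicField.isCyclotomicExtension p ℚ
    · rfl
    · exact Subsingleton.elim _ _
  refine ⟨exists_isNontrivialSeveriBrauerSurface φ (CyclotomicField p ℚ) (by omega) hφ,
    SemidirectProduct.isLeast_index φ hφ (by simp) ?_⟩
  rw [Nat.card_eq_fintype_card, Fintype.card_multiplicative, ZMod.card]
  exact hp.odd_of_ne_two (by omega)
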